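/- **Setting.** Let $d,k\ge 1$ and $0<\varepsilon\le 1/2$; $\mathrm{dist}$ is the Euclidean distance on $\mathbb R^d$, $B(x,r)$ the closed ball, and $\log$ inside levels is to base $2$. Let $P$ (clients) and $\mathcal C$ (candidate centers) be finite subsets of a cube $o+[0,2^M)^d$, $M\in\mathbb Z$. For a finite non-empty $S$ put $S_x=\mathrm{dist}(x,S)$, let $S(x)$ be a closest point of $S$ to $x$ (ties broken arbitrarily), and $\mathrm{cost}(P,S)=\sum_{p\in P}S_p$. A solution is a subset of $\mathcal C$ of size $k$. A *hierarchical decomposition* $\mathcal D$ of $\mathbb R^d$ consists of a partition for every level $i\in\mathbb Z$, each refining the partition of level $i+1$, and trivial from some level on. The level at which a set is *cut* is the largest level whose partition splits it ($-\infty$ if there is none, with $2^{-\infty}=0$); $\mathrm{level}(x,r)$ is the level at which $B(x,r)$ is cut. The *randomly shifted quadtree* has, at level $i<M$, the cells of side $2^{i+1}$ of the grid with corner $o-a$, and a single part from level $M$ on, where $a$ is uniform in $[0,2^M)^d$. Let $\tau=\log d+\log(1/\varepsilon)$. The ball $B(x,r)$ is *badly cut* if it is cut and $\mathrm{level}(x,r)\ge\log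 r+\tau$; a point $x$ is badly cut w.r.t. $S$ if $B(x,3S_x)$ is. For $v\ge0$ let $\beta(x,r,v)=\varepsilon 2^{\mathrm{level}(x,r)}$ if $\mathrm{level}(x,r)\le\log r+\tau$ (with $\log 0=-\infty$), and $\beta(x,r,v)=v$ otherwise. The *$k$-median budget* of $p$ w.r.t. $\mathcal A$ and $S$ is $$b(p,\varepsilon)=\beta(p,3\mathcal A_p,0)+\beta\big(p,3(\mathcal A_p+S_p),3\mathcal A_p+2S_p\big)+\beta\big(\mathcal A(p),3S_{\mathcal A(p)},0\big).$$ Let $\tilde p=\mathcal A(p)$ if $p$ is badly cut w.r.t. $\mathcal A$, and $\tilde p=p$ otherwise. **Theorem.** There is an absolute constant $K>0$ such that the following holds for all such $d,k,\varepsilon,o,M,P,\mathcal C$ and every solution $\mathcal A$ (with any tie-breaking for $\mathcal A(\cdot)$). 1. For every fixed non-empty $S\subseteq\mathcal C$ with $|S|\le k$, with probability at least $2/3$ over the randomly shifted quadtree, $$\sum_{p\in P}b(p,\varepsilon)\le K\,d\,\ln(1/\varepsilon)\,\varepsilon\,\big(\mathrm{cost}(P,\mathcal A)+\mathrm{cost}(P,S)\big).$$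 2. Let $\mathrm{OPT}$ be an optimal solution. For $\ell\in\mathcal A$ let $\psi(\ell)=\{g\in\mathrm{OPT}:\mathcal A(g)=\ell\}$ and, if $\psi(\ell)\neq\emptyset$, let $f_\ell$ be a closest point of $\psi(\ell)$ to $\ell$ (ties broken arbitrarily); let $\mathrm{OPT}^{\ge2}=\{g\in\mathrm{OPT}:|\psi(\mathcal A(g))|\ge2\}$. There is a set $\mathcal H\subseteq\mathrm{OPT}^{\ge2}$, not depending on the random shift, that contains no $f_\ell$, has $|\mathcal H|\le K\varepsilon|\mathrm{OPT}^{\ge2}|$, and for which $\mathrm{OPT}'=\mathrm{OPT}\setminus\mathcal H$ has $\mathrm{cost}(P,\mathrm{OPT}')\le(1+K\varepsilon)\,\mathrm{cost}(P,\mathrm{OPT})+K\varepsilon\,\mathrm{cost}(P,\mathcal A)$, such that the following holds. For a hierarchical decomposition $\mathcal D$ let $B_{\mathcal D}$ be the set of $\ell\in\mathcal A$ that are badly cut w.r.t. $\mathrm{OPT}'$, and let $\mathcal S^*$ arise from $\mathrm{OPT}'$ by replacing $f_\ell$ by $\ell$ for each $\ell\in B_{\mathcal D}$ with $\psi(\ell)\ne\emptyset$,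 and adding each $\ell\in B_{\mathcal D}$ with $\psi(\ell)=\emptyset$. Budgets are now w.r.t. $\mathcal A$ and $\mathrm{OPT}'$. - (a) For every hierarchical decomposition $\mathcal D$: $B_{\mathcal D}\subseteq\mathcal S^*\subseteq\mathcal C$, and for every $p\in P$ there is $s\in\mathcal S^*$ such that, if $i$ is the level at which $\tilde p$ and $s$ are cut, $$\mathrm{dist}(p,\tilde p)+\mathrm{dist}(\tilde p,s)+\varepsilon2^i\le\mathrm{dist}(p,\tilde p)+\mathrm{dist}(\tilde p,\mathcal S^*)+b(p,\varepsilon).$$ - (b) For the randomly shifted quadtree, with probability at least $4/5$: $|\mathcal S^*|\le k$, and both $\mathrm{cost}(P,\mathcal S^*)$ and $\sum_{p\in P}\big(\mathrm{dist}(p,\tilde p)+\mathrm{dist}(\tilde p,\mathcal S^*)\big)$ are at most $(1+K\varepsilon)\,\mathrm{cost}(P,\mathrm{OPT})+K\varepsilon\,\mathrm{cost}(P,\mathcal A)$. - (c) For the randomly shifted quadtree, with probability at least $2/3$ all of these hold at once: $\sum_{p\in P}b(p,\varepsilon)\le K\,d\,\ln(1/\varepsilon)\,\varepsilon\,(\mathrm{cost}(P,\mathcal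 A)+\mathrm{cost}(P,\mathrm{OPT}))$, $|\mathcal S^*|\le k$, and $\sum_{p\in P}(\mathrm{dist}(p,\tilde p)+\mathrm{dist}(\tilde p,\mathcal S^*))\le(1+K\varepsilon)\,\mathrm{cost}(P,\mathrm{OPT})+K\varepsilon\,\mathrm{cost}(P,\mathcal A)$. -/

import Mathlib

open MeasureTheory

noncomputable section

/-- The Euclidean space `ℝ^d` with the `ℓ₂` metric. -/
abbrev Pt (d : ℕ) : Type := EuclideanSpace ℝ (Fin d)

/-! ### Hierarchical decompositions -/

/-- A hierarchical decomposition of a space: a partition for every level `i ∈ ℤ`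
(written as an equivalence relation), each refining the next, and with only one part from some
top level on. -/
structure HierDecomp (X : Type) where
  part : ℤ → Setoid X
  refines : ∀ i x y, (part i).r x y → (part (i + 1)).r x y
  has_top : ∃ M : ℤ, ∀ i, M ≤ i → ∀ x y, (part i).r x y

/-- The set `B` is split by the partition of level `i`: it meets two different parts. -/
def HierDecomp.CutsAt {X : Type} (D : HierDecomp X) (i : ℤ) (B : Set X) : Prop :=
  ∃ x ∈ B, ∃ y ∈ B, ¬ (D.part i).r x y

open Classical in
/-- The level at which `B` is cut: the largest level whose partition splits `B`, and `⊥`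
(that is, `-∞`) if no level does. -/
def HierDecomp.cutLevel {X : Type} (D : HierDecomp X) (B : Set X) : WithBot ℤ :=
  if h : ∃ i, IsGreatest {i | D.CutsAt i B} i then (h.choose : WithBot ℤ) else ⊥

/-- `2 ^ i` for a level `i`, with `2 ^ (-∞) = 0`. -/
def twoPow (l : WithBot ℤ) : ℝ := WithBot.recBotCoe 0 (fun i : ℤ => (2 : ℝ) ^ i) l

/-- `level(x, r)`, the level at which the closed ball `B(x, r)` is cut. -/
def HierDecomp.level {d : ℕ} (D : HierDecomp (Pt d)) (x : Pt d) (r : ℝ) : WithBot ℤ :=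
  D.cutLevel (Metric.closedBall x r)

/-! ### The randomly shifted quadtree -/

/-- Index of the cell of the grid of side `2 ^ (i + 1)`, with lower corner `o - a`,
that contains `x`. -/
def gridIndex {d : ℕ} (o : Pt d) (a : Fin d → ℝ) (i : ℤ) (x : Pt d) : Fin d → ℤ :=
  fun j => ⌊(x j - o j + a j) / (2 : ℝ) ^ (i + 1)⌋

theorem gridIndex_refines {d : ℕ} (o : Pt d) (a : Fin d → ℝ) (i : ℤ) (x y : Pt d)
    (h : gridIndex o a i x = gridIndex o a i y) :
    gridIndex o a (i + 1) x = gridIndex o a (i + 1) y := by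
  have key : ∀ t : ℝ, ⌊t / (2 : ℝ) ^ (i + 1 + 1)⌋ = ⌊t / (2 : ℝ) ^ (i + 1)⌋ / 2 := by
    intro t
    have e : t / (2 : ℝ) ^ (i + 1 + 1) = t / (2 : ℝ) ^ (i + 1) / ((2 : ℕ) : ℝ) := by
      rw [zpow_add_one₀ (two_ne_zero) (i + 1), div_div]
      norm_num
    rw [e, Int.floor_div_natCast]
    norm_num
  funext j
  have hj := congrFun h j
  simp only [gridIndex] at hj ⊢
  rw [key, key, hj]

/-- The quadtree with shift `a` and root level `M`. At level `i < M` the parts are the cells of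
side `2 ^ (i + 1)` of the grid shifted by `a`; from level `M` on the root is the only part.
If `0 ≤ a j < 2 ^ M`, then the cube of side `2 ^ (M + 1)` with lower corner `o - a`, of which the
cells of level `M - 1` are the `2 ^ d` children, contains the cube `o + [0, 2 ^ M) ^ d`. -/
def quadtree {d : ℕ} (M : ℤ) (o : Pt d) (a : Fin d → ℝ) : HierDecomp (Pt d) where
  part i := Setoid.comap (fun x => if i < M then gridIndex o a i x else 0) ⊥
  refines i x y h := by
    change (if i < M then gridIndex o a i x else 0) = (if i < M then gridIndex o a i y else 0) at h
    change (if i + 1 < M then gridIndex o a (i + 1) x else 0) =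
      (if i + 1 < M then gridIndex o a (i + 1) y else 0)
    by_cases h1 : i + 1 < M
    · have h2 : i < M := by omega
      rw [if_pos h2, if_pos h2] at h
      rw [if_pos h1, if_pos h1]
      exact gridIndex_refines o a i x y h
    · rw [if_neg h1, if_neg h1]
  has_top := by
    refine ⟨M, fun i hi x y => ?_⟩
    change (if i < M then gridIndex o a i x else 0) = (if i < M then gridIndex o a i y else 0)
    rw [if_neg (not_lt.mpr hi), if_neg (not_lt.mpr hi)]

/-- The law of the random shift: independent coordinates, each uniform on `[0, 2 ^ M)`. -/
def shiftLaw (d : ℕ) (M : ℤ) : Measure (Fin d → ℝ) :=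
  Measure.pi fun _ => ProbabilityTheory.cond (volume : Measure ℝ) (Set.Ico 0 ((2 : ℝ) ^ M))

/-! ### The `k`-median problem -/

/-- `dist(x, S)`, the distance from `x` to its closest point in `S`. -/
def distTo {d : ℕ} (S : Finset (Pt d)) (x : Pt d) : ℝ := Metric.infDist x (S : Set (Pt d))

/-- The `k`-median cost of the centers `S` for the clients `P`. -/
def kmCost {d : ℕ} (P S : Finset (Pt d)) : ℝ := ∑ p ∈ P, distTo S p

/-- A solution: `k` of the candidate centers. -/
def IsSolution {d : ℕ} (k : ℕ) (Cand S : Finset (Pt d)) : Prop := S ⊆ Cand ∧ S.card = k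

/-- A solution of minimum `k`-median cost. -/
def IsOptimalSolution {d : ℕ} (k : ℕ) (Cand P S : Finset (Pt d)) : Prop :=
  IsSolution k Cand S ∧ ∀ T, IsSolution k Cand T → kmCost P S ≤ kmCost P T

/-- `near` sends every point to a closest point of `S` (with some tie-breaking). -/
def IsNearestMap {d : ℕ} (S : Finset (Pt d)) (near : Pt d → Pt d) : Prop :=
  ∀ x, near x ∈ S ∧ ∀ s ∈ S, dist x (near x) ≤ dist x s

/-! ### Badly cut points and budgets -/

/-- The parameter `τ(ε, d) = log d + log (1/ε)`, with logarithms to base two. -/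
def tau (ε : ℝ) (d : ℕ) : ℝ := Real.logb 2 d + Real.logb 2 (1 / ε)

/-- `B(x, r)` is badly cut: `level(x, r) ≥ log r + τ(ε, d)`, in exponentiated form. A ball that
is not cut at all is not badly cut. -/
def BadlyCutBall {d : ℕ} (D : HierDecomp (Pt d)) (ε : ℝ) (x : Pt d) (r : ℝ) : Prop :=
  D.level x r ≠ ⊥ ∧ r * (2 : ℝ) ^ tau ε d ≤ twoPow (D.level x r)

/-- The point `x` is badly cut w.r.t. the set `S`. -/
def BadlyCut {d : ℕ} (D : HierDecomp (Pt d)) (ε : ℝ) (S : Finset (Pt d)) (x : Pt d) : Prop :=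
  BadlyCutBall D ε x (3 * distTo S x)

/-- The `k`-median detour of the ball `B(x, r)`. -/
def detour {d : ℕ} (D : HierDecomp (Pt d)) (ε : ℝ) (x : Pt d) (r : ℝ) : ℝ :=
  ε * twoPow (D.level x r)

open Classical in
/-- The detour of `B(x, r)` if `level(x, r) ≤ log r + τ(ε, d)`, and `v` otherwise. -/
def detourOr {d : ℕ} (D : HierDecomp (Pt d)) (ε : ℝ) (x : Pt d) (r v : ℝ) : ℝ :=
  if twoPow (D.level x r) ≤ r * (2 : ℝ) ^ tau ε d then detour D ε x r else v

def budget₁ {d : ℕ} (D : HierDecomp (Pt d)) (ε : ℝ) (A : Finset (Pt d)) (p : Pt d) : ℝ :=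
  detourOr D ε p (3 * distTo A p) 0

def budget₂ {d : ℕ} (D : HierDecomp (Pt d)) (ε : ℝ) (A S : Finset (Pt d)) (p : Pt d) : ℝ :=
  detourOr D ε p (3 * (distTo A p + distTo S p)) (3 * distTo A p + 2 * distTo S p)

def budget₃ {d : ℕ} (D : HierDecomp (Pt d)) (ε : ℝ) (near : Pt d → Pt d) (S : Finset (Pt d))
    (p : Pt d) : ℝ :=
  detourOr D ε (near p) (3 * distTo S (near p)) 0

/-- The `k`-median budget of `p` w.r.t. `A` and `S`, where `near p` is the center `A(p)`. -/
def budget {d : ℕ} (D : HierDecomp (Pt d)) (ε : ℝ) (A : Finset (Pt d)) (near : Pt d → Pt d)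
    (S : Finset (Pt d)) (p : Pt d) : ℝ :=
  budget₁ D ε A p + budget₂ D ε A S p + budget₃ D ε near S p

open Classical in
/-- The modified client: `A(p)` if `p` is badly cut w.r.t. `A`, and `p` otherwise. -/
def moved {d : ℕ} (D : HierDecomp (Pt d)) (ε : ℝ) (A : Finset (Pt d)) (near : Pt d → Pt d)
    (p : Pt d) : Pt d :=
  if BadlyCut D ε A p then near p else p

/-! ### The structured solution -/

open Classical in
/-- `ψ(ℓ)`: the centers of `OPT` whose closest center in `A` is `ℓ`. -/
def psi {d : ℕ} (near : Pt d → Pt d) (OPT : Finset (Pt d)) (l : Pt d) : Finset (Pt d) :=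
  OPT.filter fun g => near g = l

open Classical in
/-- `OPT^{≥2}`: the centers of `OPT` that share their closest center in `A` with another one. -/
def optMulti {d : ℕ} (near : Pt d → Pt d) (OPT : Finset (Pt d)) : Finset (Pt d) :=
  OPT.filter fun g => 2 ≤ (psi near OPT (near g)).card

/-- `f` picks, for every `ℓ ∈ A` with `ψ(ℓ) ≠ ∅`, a center of `ψ(ℓ)` closest to `ℓ`. -/
def IsClosestChoice {d : ℕ} (near : Pt d → Pt d) (A OPT : Finset (Pt d))
    (f : Pt d → Pt d) : Prop :=
  ∀ l ∈ A, (psi near OPT l).Nonempty →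
    f l ∈ psi near OPT l ∧ ∀ g ∈ psi near OPT l, dist l (f l) ≤ dist l g

open Classical in
/-- `OPT' = OPT ∖ H`. -/
def removeCenters {d : ℕ} (OPT H : Finset (Pt d)) : Finset (Pt d) := OPT \ H

open Classical in
/-- `B_D`: the centers of `A` that are badly cut w.r.t. `OPT'`. -/
def badCenters {d : ℕ} (D : HierDecomp (Pt d)) (ε : ℝ) (A OPT' : Finset (Pt d)) :
    Finset (Pt d) :=
  A.filter fun l => BadlyCut D ε OPT' l

open Classical in
/-- `S*`: starting from `OPT' = OPT ∖ H`, replace `f ℓ` by `ℓ` for every `ℓ ∈ B_D` with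
`ψ(ℓ) ≠ ∅`, and add every `ℓ ∈ B_D` with `ψ(ℓ) = ∅`. -/
def sStar {d : ℕ} (D : HierDecomp (Pt d)) (ε : ℝ) (A : Finset (Pt d)) (near : Pt d → Pt d)
    (OPT H : Finset (Pt d)) (f : Pt d → Pt d) : Finset (Pt d) :=
  let B := badCenters D ε A (removeCenters OPT H)
  (removeCenters OPT H \ (B.filter fun l => (psi near OPT l).Nonempty).image f) ∪ B

/-- The sum over the clients of `dist(p, p̃) + dist(p̃, S)`. -/
def movedCost {d : ℕ} (D : HierDecomp (Pt d)) (ε : ℝ) (A : Finset (Pt d)) (near : Pt d → Pt d)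
    (P S : Finset (Pt d)) : ℝ :=
  ∑ p ∈ P, (dist p (moved D ε A near p) + distTo S (moved D ε A near p))

/-- Some `s ∈ S`, cut from `p̃` at level `i`, satisfies
`dist(p, p̃) + dist(p̃, s) + ε 2^i ≤ dist(p, p̃) + dist(p̃, S) + b`. -/
def DetourWithin {d : ℕ} (D : HierDecomp (Pt d)) (ε : ℝ) (A : Finset (Pt d))
    (near : Pt d → Pt d) (S : Finset (Pt d)) (p : Pt d) (b : ℝ) : Prop :=
  ∃ s ∈ S,
    dist p (moved D ε A near p) + dist (moved D ε A near p) s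
        + ε * twoPow (D.cutLevel {moved D ε A near p, s})
      ≤ dist p (moved D ε A near p) + distTo S (moved D ε A near p) + b

end

/-! ### Levels at which sets are cut -/

/-! Two facts about one ball carry everything. A union bound over coordinates shows that the shifted
grid of level `i` splits `B(x,r)` with probability at most `2dr/2^i` (`shiftLaw_cutsAt_le`). Hence a
ball is badly cut with probability at most `2ε`. Its detour, restricted to levels that are not too
high, has mean `O(ε d r log(1/ε))`: levels with `2^i ≤ rd` add at most `rd` in all to `2^level`, and
each of the `O(log(1/ε))` levels above adds at most `2dr`. Summing over clients and applying
Markov's inequality bounds the budget.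

For the detour guarantee, `S*` keeps each `g ∈ OPT'` or contains `A(g)`, and `A(g)` is no further
from `g` than any other center of `A`. So `S*` is within `2·OPT'_x + A_x` of every `x`, and the
balls in the budget contain both `p̃` and a suitable center. When the middle ball is cut too high,
the route passes through `A(p)`, and the default value of the budget pays for its length
(`detourWithin_sStar`).

For the size, exchanging `f ℓ` for `ℓ` changes nothing, so only badly cut `ℓ` with `ψ(ℓ) = ∅`
enlarge the set. Since `|A| = |OPT|`, there are as many idle `ℓ` as centers of `OPT` that are no `f
ℓ`. Removing the cheapest `40ε` fraction of the latter makes room for the `O(ε)` fraction of the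
former that is badly cut, and averaging keeps the cost of removal at `O(ε)`
(`exists_removedCenters`). As `OPT'` is fixed before the shift, the bound `2ε` applies to points
badly cut with respect to it, which also controls the cost of `S*`. -/

@[simp] theorem twoPow_bot : twoPow ⊥ = 0 := rfl

@[simp] theorem twoPow_coe (i : ℤ) : twoPow (i : WithBot ℤ) = (2 : ℝ) ^ i := rfl

theorem twoPow_nonneg (l : WithBot ℤ) : 0 ≤ twoPow l := by
  induction l using WithBot.recBotCoe with
  | bot => simp
  | coe i => simp only [twoPow_coe]; positivity

namespace HierDecomp

theorem refines_le {X : Type} (D : HierDecomp X) {i j : ℤ} (hij : i ≤ j) {x y : X}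
    (h : (D.part i).r x y) : (D.part j).r x y := by
  induction j, hij using Int.leInduction with
  | base => exact h
  | succ j _ ih => exact D.refines j x y ih

theorem CutsAt.anti {X : Type} {D : HierDecomp X} {i j : ℤ} {B : Set X} (h : D.CutsAt j B)
    (hij : i ≤ j) : D.CutsAt i B := by
  obtain ⟨x, hx, y, hy, hxy⟩ := h
  exact ⟨x, hx, y, hy, fun h' => hxy (D.refines_le hij h')⟩

theorem CutsAt.mono {X : Type} {D : HierDecomp X} {i : ℤ} {A B : Set X} (h : D.CutsAt i A)
    (hAB : A ⊆ B) : D.CutsAt i B := by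
  obtain ⟨x, hx, y, hy, hxy⟩ := h
  exact ⟨x, hAB hx, y, hAB hy, hxy⟩

/-- The top level bounds the cut levels from above, so the default `⊥` occurs only when no level
cuts the set. -/
theorem cutLevel_cases {X : Type} (D : HierDecomp X) (B : Set X) :
    (D.cutLevel B = ⊥ ∧ ∀ i, ¬ D.CutsAt i B) ∨
      ∃ i : ℤ, D.cutLevel B = i ∧ D.CutsAt i B ∧ ∀ j, D.CutsAt j B → j ≤ i := by
  by_cases h : ∃ i, IsGreatest {i | D.CutsAt i B} i
  · right
    refine ⟨h.choose, by simp [cutLevel, h], h.choose_spec.1, fun j hj => h.choose_spec.2 hj⟩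
  · left
    refine ⟨by simp [cutLevel, h], fun i hi => h ?_⟩
    obtain ⟨M, hM⟩ := D.has_top
    obtain ⟨m, hm, hmax⟩ := Int.exists_greatest_of_bdd (P := fun i => D.CutsAt i B)
      ⟨M, fun z hz => by
        by_contra hlt
        obtain ⟨x, _, y, _, hxy⟩ := hz
        exact hxy (hM z (by omega) x y)⟩ ⟨i, hi⟩
    exact ⟨m, hm, fun j hj => hmax j hj⟩

theorem CutsAt.le_twoPow {X : Type} {D : HierDecomp X} {i : ℤ} {B : Set X} (h : D.CutsAt i B) :
    (2 : ℝ) ^ i ≤ twoPow (D.cutLevel B) := by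
  rcases D.cutLevel_cases B with ⟨_, h0⟩ | ⟨j, hj, _, hmax⟩
  · exact absurd h (h0 i)
  · rw [hj, twoPow_coe]
    exact zpow_le_zpow_right₀ one_le_two (hmax i h)

theorem twoPow_cutLevel_le {X : Type} (D : HierDecomp X) (B : Set X) {c : ℝ} (hc : 0 ≤ c)
    (h : ∀ i, D.CutsAt i B → (2 : ℝ) ^ i ≤ c) : twoPow (D.cutLevel B) ≤ c := by
  rcases D.cutLevel_cases B with ⟨h0, _⟩ | ⟨j, hj, hc', _⟩
  · simpa [h0] using hc
  · rw [hj, twoPow_coe]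
    exact h j hc'

theorem twoPow_cutLevel_mono {X : Type} (D : HierDecomp X) {A B : Set X} (hAB : A ⊆ B) :
    twoPow (D.cutLevel A) ≤ twoPow (D.cutLevel B) :=
  D.twoPow_cutLevel_le A (twoPow_nonneg _) fun _ hi => (hi.mono hAB).le_twoPow

theorem cutsAt_pair_iff {X : Type} (D : HierDecomp X) (i : ℤ) (x y : X) :
    D.CutsAt i {x, y} ↔ ¬ (D.part i).r x y := by
  have hrefl := (D.part i).iseqv.refl
  constructor
  · rintro ⟨u, hu, v, hv, huv⟩ h
    have h' := (D.part i).iseqv.symm h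
    rcases hu with rfl | rfl <;> rcases hv with rfl | rfl
    exacts [huv (hrefl _), huv h, huv h', huv (hrefl _)]
  · exact fun h => ⟨x, by simp, y, by simp, h⟩

theorem twoPow_cutLevel_self {X : Type} (D : HierDecomp X) (x : X) :
    twoPow (D.cutLevel {x, x}) ≤ 0 :=
  D.twoPow_cutLevel_le _ le_rfl fun i hi =>
    absurd ((D.part i).iseqv.refl x) ((D.cutsAt_pair_iff i x x).1 hi)

/-- A partition that separates `x` from `z` separates `y` from one of them. This gives even the
ultrametric inequality, but the sum suffices. -/
theorem twoPow_cutLevel_triangle {X : Type} (D : HierDecomp X) (x y z : X) :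
    twoPow (D.cutLevel {x, z}) ≤ twoPow (D.cutLevel {x, y}) + twoPow (D.cutLevel {y, z}) := by
  refine D.twoPow_cutLevel_le _ (add_nonneg (twoPow_nonneg _) (twoPow_nonneg _)) fun i hi => ?_
  rw [cutsAt_pair_iff] at hi
  by_cases hxy : (D.part i).r x y
  · have hyz : D.CutsAt i {y, z} :=
      (D.cutsAt_pair_iff i y z).2 fun h => hi ((D.part i).iseqv.trans hxy h)
    linarith [hyz.le_twoPow, twoPow_nonneg (D.cutLevel {x, y})]
  · have := ((D.cutsAt_pair_iff i x y).2 hxy).le_twoPow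
    linarith [twoPow_nonneg (D.cutLevel {y, z})]

theorem twoPow_cutLevel_pair_le_level {d : ℕ} (D : HierDecomp (Pt d)) {x y : Pt d} {r : ℝ}
    (h : dist x y ≤ r) : twoPow (D.cutLevel {x, y}) ≤ twoPow (D.level x r) := by
  refine D.twoPow_cutLevel_mono ?_
  rintro z (rfl | rfl)
  · exact Metric.mem_closedBall_self (dist_nonneg.trans h)
  · rwa [Metric.mem_closedBall, dist_comm]

end HierDecomp

/-! ### Nearest points -/

theorem distTo_nonneg {d : ℕ} (S : Finset (Pt d)) (x : Pt d) : 0 ≤ distTo S x :=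
  Metric.infDist_nonneg

theorem distTo_le_dist {d : ℕ} {S : Finset (Pt d)} {s : Pt d} (hs : s ∈ S) (x : Pt d) :
    distTo S x ≤ dist x s :=
  Metric.infDist_le_dist_of_mem hs

theorem distTo_le_add {d : ℕ} (S : Finset (Pt d)) (x y : Pt d) :
    distTo S x ≤ dist x y + distTo S y := by
  have := Metric.infDist_le_infDist_add_dist (s := (S : Set (Pt d))) (x := x) (y := y)
  simp only [distTo]
  linarith

theorem kmCost_nonneg {d : ℕ} (P S : Finset (Pt d)) : 0 ≤ kmCost P S :=
  Finset.sum_nonneg fun _ _ => distTo_nonneg _ _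

theorem IsNearestMap.distTo_eq {d : ℕ} {S : Finset (Pt d)} {near : Pt d → Pt d}
    (h : IsNearestMap S near) (x : Pt d) : distTo S x = dist x (near x) := by
  refine le_antisymm (distTo_le_dist (h x).1 x) ?_
  exact (Metric.le_infDist ⟨near x, (h x).1⟩).2 fun s hs => (h x).2 s hs

theorem exists_isNearestMap {d : ℕ} {S : Finset (Pt d)} (hS : S.Nonempty) :
    ∃ near : Pt d → Pt d, IsNearestMap S near := by
  choose near h using fun x : Pt d => Finset.exists_min_image S (fun s => dist x s) hS
  exact ⟨near, fun x => ⟨(h x).1, (h x).2⟩⟩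

/-! ### Detours -/

theorem rpow_tau {d : ℕ} {ε : ℝ} (hd : 1 ≤ d) (hε : 0 < ε) : (2 : ℝ) ^ tau ε d = d / ε := by
  have hd' : (0 : ℝ) < d := by exact_mod_cast hd
  rw [tau, Real.rpow_add two_pos, Real.rpow_logb two_pos (by norm_num) hd',
    Real.rpow_logb two_pos (by norm_num) (by positivity)]
  ring

theorem detour_nonneg {d : ℕ} (D : HierDecomp (Pt d)) {ε : ℝ} (hε : 0 ≤ ε) (x : Pt d) (r : ℝ) :
    0 ≤ detour D ε x r :=
  mul_nonneg hε (twoPow_nonneg _)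

theorem detourOr_nonneg {d : ℕ} (D : HierDecomp (Pt d)) {ε : ℝ} (hε : 0 ≤ ε) (x : Pt d) (r : ℝ)
    {v : ℝ} (hv : 0 ≤ v) : 0 ≤ detourOr D ε x r v := by
  unfold detourOr
  split_ifs
  exacts [detour_nonneg D hε x r, hv]

/-- The two conditions overlap at equality of level and threshold, so they are not complementary,
but failing to be badly cut does force the first branch. -/
theorem detourOr_of_not_badlyCutBall {d : ℕ} {D : HierDecomp (Pt d)} {ε : ℝ} {x : Pt d} {r : ℝ}
    (hr : 0 ≤ r) (h : ¬ BadlyCutBall D ε x r) (v : ℝ) : detourOr D ε x r v = detour D ε x r := by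
  have h2 : (0 : ℝ) ≤ 2 ^ tau ε d := by positivity
  refine if_pos ?_
  by_contra hlt
  refine h ⟨fun hbot => hlt ?_, (not_le.1 hlt).le⟩
  rw [hbot, twoPow_bot]
  positivity

theorem budget_nonneg {d : ℕ} (D : HierDecomp (Pt d)) {ε : ℝ} (hε : 0 ≤ ε) (A : Finset (Pt d))
    (near : Pt d → Pt d) (S : Finset (Pt d)) (p : Pt d) : 0 ≤ budget D ε A near S p := by
  have hA := distTo_nonneg A p
  have hS := distTo_nonneg S p
  exact add_nonneg (add_nonneg (detourOr_nonneg D hε _ _ le_rfl)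
    (detourOr_nonneg D hε _ _ (by linarith))) (detourOr_nonneg D hε _ _ le_rfl)

/-! ### The structured solution -/

theorem mem_psi {d : ℕ} {near : Pt d → Pt d} {OPT : Finset (Pt d)} {l g : Pt d} :
    g ∈ psi near OPT l ↔ g ∈ OPT ∧ near g = l := by
  simp [psi]

theorem mem_removeCenters {d : ℕ} {OPT H : Finset (Pt d)} {g : Pt d} :
    g ∈ removeCenters OPT H ↔ g ∈ OPT ∧ g ∉ H := by
  simp [removeCenters]

theorem mem_badCenters {d : ℕ} {D : HierDecomp (Pt d)} {ε : ℝ} {A O : Finset (Pt d)} {l : Pt d} :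
    l ∈ badCenters D ε A O ↔ l ∈ A ∧ BadlyCut D ε O l := by
  simp [badCenters]

theorem badCenters_subset_sStar {d : ℕ} (D : HierDecomp (Pt d)) (ε : ℝ) (A : Finset (Pt d))
    (near : Pt d → Pt d) (OPT H : Finset (Pt d)) (f : Pt d → Pt d) :
    badCenters D ε A (removeCenters OPT H) ⊆ sStar D ε A near OPT H f := by
  unfold sStar
  exact Finset.subset_union_right

theorem sStar_subset {d : ℕ} (D : HierDecomp (Pt d)) (ε : ℝ) {A Cand : Finset (Pt d)}
    (near : Pt d → Pt d) {OPT : Finset (Pt d)} (H : Finset (Pt d)) (f : Pt d → Pt d)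
    (hA : A ⊆ Cand) (hO : OPT ⊆ Cand) : sStar D ε A near OPT H f ⊆ Cand := by
  intro x hx
  simp only [sStar, Finset.mem_union, Finset.mem_sdiff, mem_removeCenters, mem_badCenters] at hx
  rcases hx with h | h
  exacts [hO h.1.1, hA h.1]

/-- A center of `OPT'` is in `S*`, or its closest center of `A` is badly cut and in `S*`. -/
theorem mem_sStar_or {d : ℕ} (D : HierDecomp (Pt d)) (ε : ℝ) {A : Finset (Pt d)}
    {near : Pt d → Pt d} {OPT H : Finset (Pt d)} {f : Pt d → Pt d}
    (hf : IsClosestChoice near A OPT f) {g : Pt d} (hg : g ∈ removeCenters OPT H) :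
    g ∈ sStar D ε A near OPT H f ∨
      (near g ∈ sStar D ε A near OPT H f ∧ BadlyCut D ε (removeCenters OPT H) (near g)) := by
  classical
  by_cases hgi : g ∈ ((badCenters D ε A (removeCenters OPT H)).filter
      fun l => (psi near OPT l).Nonempty).image f
  · right
    obtain ⟨l, hl, rfl⟩ := Finset.mem_image.1 hgi
    obtain ⟨hlB, hne⟩ := Finset.mem_filter.1 hl
    have hlA := mem_badCenters.1 hlB
    have : near (f l) = l := (mem_psi.1 (hf l hlA.1 hne).1).2
    rw [this]
    exact ⟨badCenters_subset_sStar D ε A near OPT H f hlB, hlA.2⟩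
  · left
    simp only [sStar, Finset.mem_union, Finset.mem_sdiff]
    left
    refine ⟨hg, fun hgi' => hgi ?_⟩
    convert hgi'

theorem removeCenters_nonempty {d : ℕ} {A : Finset (Pt d)} {near : Pt d → Pt d}
    {OPT H : Finset (Pt d)} {f : Pt d → Pt d} (hnear : IsNearestMap A near)
    (hf : IsClosestChoice near A OPT f) (hO : OPT.Nonempty)
    (hH : ∀ l ∈ A, (psi near OPT l).Nonempty → f l ∉ H) : (removeCenters OPT H).Nonempty := by
  obtain ⟨g, hg⟩ := hO
  have hne : (psi near OPT (near g)).Nonempty := ⟨g, mem_psi.2 ⟨hg, rfl⟩⟩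
  exact ⟨f (near g), mem_removeCenters.2
    ⟨(mem_psi.1 (hf _ (hnear g).1 hne).1).1, hH _ (hnear g).1 hne⟩⟩

/-- A closest center `g` of `OPT'` to `x` yields a center of `S*` not much further away. -/
theorem exists_mem_sStar_dist_le {d : ℕ} (D : HierDecomp (Pt d)) (ε : ℝ) {A : Finset (Pt d)}
    {near : Pt d → Pt d} {OPT H : Finset (Pt d)} {f : Pt d → Pt d} (hnear : IsNearestMap A near)
    (hf : IsClosestChoice near A OPT f) {g : Pt d} (hg : g ∈ removeCenters OPT H) (x : Pt d) :
    ∃ s ∈ sStar D ε A near OPT H f, dist x s ≤ 2 * dist x g + distTo A x := by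
  have hA := distTo_nonneg A x
  rcases mem_sStar_or D ε hf hg with h | ⟨h, _⟩
  · exact ⟨g, h, by linarith [dist_nonneg (x := x) (y := g)]⟩
  · refine ⟨_, h, ?_⟩
    -- The replacement `near g` is at least as close to `g` as `near x` is, and `dist g (near x) ≤
    -- dist x g + A_x`.
    have h1 := (hnear g).2 _ (hnear x).1
    have h2 := hnear.distTo_eq x
    linarith [dist_triangle x g (near g), dist_triangle g x (near x), dist_comm g x]

/-- The nearest center of `S*` lies within `2·O_{A(p)}` of `A(p)` and within `2·O_p + A_p` of `p`,
so it falls inside the ball of the third and of the second budget respectively. A badly cut `A(p)`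
needs no ball, being itself in `S*`. -/
theorem detourWithin_sStar {d : ℕ} (D : HierDecomp (Pt d)) {ε : ℝ} (hε : 0 ≤ ε)
    {A : Finset (Pt d)} {near : Pt d → Pt d} {OPT H : Finset (Pt d)} {f : Pt d → Pt d}
    (hnear : IsNearestMap A near) (hf : IsClosestChoice near A OPT f)
    (hO : (removeCenters OPT H).Nonempty) (p : Pt d) :
    DetourWithin D ε A near (sStar D ε A near OPT H f) p
      (budget D ε A near (removeCenters OPT H) p) := by
  set O := removeCenters OPT H with hOdef
  set S := sStar D ε A near OPT H f with hSdef
  obtain ⟨nO, hnO⟩ := exists_isNearestMap hO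
  have hSne : S.Nonempty := by
    obtain ⟨g, hg⟩ := hO
    obtain ⟨s, hs, _⟩ := exists_mem_sStar_dist_le D ε hnear hf hg 0
    exact ⟨s, hs⟩
  obtain ⟨nS, hnS⟩ := exists_isNearestMap hSne
  have hAp := distTo_nonneg A p
  have hOp := distTo_nonneg O p
  have hOl := distTo_nonneg O (near p)
  have hApe := hnear.distTo_eq p
  have hb1 : 0 ≤ budget₁ D ε A p := detourOr_nonneg D hε _ _ le_rfl
  have hb2 : 0 ≤ budget₂ D ε A O p := detourOr_nonneg D hε _ _ (by linarith)
  have hb3 : 0 ≤ budget₃ D ε near O p := detourOr_nonneg D hε _ _ le_rfl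
  have hlS : distTo S (near p) ≤ 2 * distTo O (near p) := by
    obtain ⟨s, hs, hle⟩ := exists_mem_sStar_dist_le D ε hnear hf (hnO (near p)).1 (near p)
    have h0 : distTo A (near p) ≤ 0 := by
      simpa using distTo_le_dist (hnear p).1 (near p)
    rw [hnO.distTo_eq (near p)]
    linarith [distTo_le_dist hs (near p)]
  have hpS : distTo S p ≤ 2 * distTo O p + distTo A p := by
    obtain ⟨s, hs, hle⟩ := exists_mem_sStar_dist_le D ε hnear hf (hnO p).1 p
    rw [hnO.distTo_eq p]
    linarith [distTo_le_dist hs p]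
  have hcutl : ¬ BadlyCut D ε O (near p) →
      ε * twoPow (D.cutLevel {near p, nS (near p)}) ≤ budget₃ D ε near O p := by
    intro hnb
    rw [budget₃, detourOr_of_not_badlyCutBall (by linarith) hnb]
    refine mul_le_mul_of_nonneg_left (D.twoPow_cutLevel_pair_le_level ?_) hε
    rw [← hnS.distTo_eq]
    linarith
  have hbad : BadlyCut D ε O (near p) → near p ∈ S := fun h =>
    badCenters_subset_sStar D ε A near OPT H f (mem_badCenters.2 ⟨(hnear p).1, h⟩)
  unfold DetourWithin budget
  by_cases hp : BadlyCut D ε A p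
  · have hm : moved D ε A near p = near p := if_pos hp
    rw [hm]
    by_cases hl : BadlyCut D ε O (near p)
    · refine ⟨near p, hbad hl, ?_⟩
      rw [dist_self]
      have := mul_le_mul_of_nonneg_left (D.twoPow_cutLevel_self (near p)) hε
      linarith [distTo_nonneg S (near p)]
    · refine ⟨nS (near p), (hnS _).1, ?_⟩
      rw [← hnS.distTo_eq]
      linarith [hcutl hl]
  · have hm : moved D ε A near p = p := if_neg hp
    rw [hm, dist_self]
    have hSp := distTo_nonneg S p
    by_cases h2 : twoPow (D.level p (3 * (distTo A p + distTo O p)))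
        ≤ 3 * (distTo A p + distTo O p) * (2 : ℝ) ^ tau ε d
    · refine ⟨nS p, (hnS _).1, ?_⟩
      rw [← hnS.distTo_eq]
      have : ε * twoPow (D.cutLevel {p, nS p}) ≤ budget₂ D ε A O p := by
        rw [budget₂, detourOr, if_pos h2]
        refine mul_le_mul_of_nonneg_left (D.twoPow_cutLevel_pair_le_level ?_) hε
        rw [← hnS.distTo_eq]
        linarith
      linarith
    -- The second ball is cut too high, so the route goes from `p` through `near p`. Its length is
    -- at most `A_p + 2·O_{A(p)} ≤ 3A_p + 2O_p`, the default value; its two cuts are paid by the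
    -- first and third budgets.
    · have hb2' : budget₂ D ε A O p = 3 * distTo A p + 2 * distTo O p := by
        rw [budget₂, detourOr, if_neg h2]
      have hcutp : ε * twoPow (D.cutLevel {p, near p}) ≤ budget₁ D ε A p := by
        rw [budget₁, detourOr_of_not_badlyCutBall (by linarith) hp]
        refine mul_le_mul_of_nonneg_left (D.twoPow_cutLevel_pair_le_level ?_) hε
        linarith
      by_cases hl : BadlyCut D ε O (near p)
      · refine ⟨near p, hbad hl, ?_⟩
        linarith
      · refine ⟨nS (near p), (hnS _).1, ?_⟩
        have h3 := mul_le_mul_of_nonneg_left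
          (D.twoPow_cutLevel_triangle p (near p) (nS (near p))) hε
        have h4 := hcutl hl
        have h5 := dist_triangle p (near p) (nS (near p))
        rw [← hnS.distTo_eq] at h5
        have h6 := distTo_le_add O (near p) p
        rw [dist_comm] at h6
        linarith

/-- The centers of `A` that are closest to no center of `OPT`. -/
noncomputable def idleCenters {d : ℕ} (near : Pt d → Pt d) (A OPT : Finset (Pt d)) :
    Finset (Pt d) :=
  open Classical in A.filter fun l => ¬ (psi near OPT l).Nonempty

open Classical in
-- `near` is a left inverse of `f` here, as `f l` belongs to `ψ(l)`.
theorem IsClosestChoice.card_image {d : ℕ} {near : Pt d → Pt d} {A OPT B : Finset (Pt d)}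
    {f : Pt d → Pt d} (hf : IsClosestChoice near A OPT f) (hB : B ⊆ A) :
    ((B.filter fun l => (psi near OPT l).Nonempty).image f).card =
      (B.filter fun l => (psi near OPT l).Nonempty).card := by
  refine Finset.card_image_of_injOn fun l hl l' hl' h => ?_
  simp only [Finset.coe_filter, Set.mem_ofPred_eq] at hl hl'
  rw [← (mem_psi.1 (hf l (hB hl.1) hl.2).1).2, ← (mem_psi.1 (hf l' (hB hl'.1) hl'.2).1).2, h]

open Classical in
-- Exchanges preserve the size because `f` is injective and its values survive in `OPT'`; the idle
-- additions are offset by the removal of `H`.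
theorem card_sStar_le {d : ℕ} (D : HierDecomp (Pt d)) (ε : ℝ) {A : Finset (Pt d)}
    {near : Pt d → Pt d} {OPT H : Finset (Pt d)} {f : Pt d → Pt d}
    (hf : IsClosestChoice near A OPT f) (hHO : H ⊆ OPT)
    (hH : ∀ l ∈ A, (psi near OPT l).Nonempty → f l ∉ H)
    (hc : ((idleCenters near A OPT).filter
      fun l => BadlyCut D ε (removeCenters OPT H) l).card ≤ H.card) :
    (sStar D ε A near OPT H f).card ≤ OPT.card := by
  set O := removeCenters OPT H with hOdef
  set B := badCenters D ε A O with hB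
  have hBA : B ⊆ A := fun l hl => (mem_badCenters.1 hl).1
  have hOc : O.card + H.card = OPT.card := by
    rw [hOdef, removeCenters]
    convert Finset.card_sdiff_add_card_eq_card hHO
  set I := (B.filter fun l => (psi near OPT l).Nonempty).image f with hI
  have hIc : I.card = (B.filter fun l => (psi near OPT l).Nonempty).card := hf.card_image hBA
  have hIsub : I ⊆ O := by
    intro g hg
    obtain ⟨l, hl, rfl⟩ := Finset.mem_image.1 hg
    obtain ⟨hlB, hne⟩ := Finset.mem_filter.1 hl
    exact mem_removeCenters.2 ⟨(mem_psi.1 (hf l (hBA hlB) hne).1).1, hH l (hBA hlB) hne⟩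
  have hBc := Finset.card_filter_add_card_filter_not (s := B)
    (fun l => (psi near OPT l).Nonempty)
  have hBe : (B.filter fun l => ¬ (psi near OPT l).Nonempty).card ≤ H.card := by
    refine le_trans (Finset.card_le_card fun l hl => ?_) hc
    simp only [idleCenters, Finset.mem_filter, hB, mem_badCenters] at hl ⊢
    tauto
  have hS : sStar D ε A near OPT H f = (O \ I) ∪ B := by
    simp only [sStar, hI, hB, hOdef]
  have h1 := Finset.card_sdiff_add_card_eq_card hIsub
  have h2 := Finset.card_union_le (O \ I) B
  rw [hS]
  omega

/-! ### The removed centers -/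

/-- The `m` cheapest elements of a finite set cost at most their share of the total. -/
theorem exists_subset_card_eq_mul_sum_le {α : Type*} (w : α → ℝ) (F : Finset α) (m : ℕ)
    (hm : m ≤ F.card) :
    ∃ H ⊆ F, H.card = m ∧ (F.card : ℝ) * ∑ g ∈ H, w g ≤ m * ∑ g ∈ F, w g := by
  classical
  induction hn : F.card - m generalizing F with
  | zero =>
    have : F.card = m := by omega
    exact ⟨F, subset_rfl, this, by rw [this]⟩
  | succ n ih =>
    have hpos : F.Nonempty := Finset.card_pos.1 (by omega)
    obtain ⟨g, hg, hmax⟩ := Finset.exists_max_image F w hpos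
    have hcard := Finset.card_erase_add_one hg
    obtain ⟨H, hH, hHm, hle⟩ := ih (F.erase g) (by omega) (by omega)
    refine ⟨H, hH.trans (Finset.erase_subset _ _), hHm, ?_⟩
    -- The discarded element is the most expensive, so it costs at least the average over `H`.
    have hs : ∑ x ∈ H, w x ≤ m * w g := by
      rw [← hHm, ← nsmul_eq_mul]
      exact Finset.sum_le_card_nsmul _ _ _ fun x hx => hmax x (Finset.mem_of_mem_erase (hH hx))
    rw [← Finset.add_sum_erase F w hg, ← hcard]
    push_cast
    linarith

open Classical in
-- A client of a removed `g` is rerouted to `f (near g)`, which survives and is as close to `near g`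
-- as `g` is. The extra length is at most `2·dist(g, near g) ≤ 2(OPT_p + A_p)`.
theorem kmCost_removeCenters_le {d : ℕ} {A : Finset (Pt d)} {near n : Pt d → Pt d}
    {P OPT H : Finset (Pt d)} {f : Pt d → Pt d} (hnear : IsNearestMap A near)
    (hn : IsNearestMap OPT n) (hf : IsClosestChoice near A OPT f)
    (hH : ∀ l ∈ A, (psi near OPT l).Nonempty → f l ∉ H) :
    kmCost P (removeCenters OPT H) ≤ kmCost P OPT +
      ∑ g ∈ H, ∑ p ∈ P, if n p = g then 2 * (distTo OPT p + distTo A p) else 0 := by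
  rw [Finset.sum_comm, kmCost, kmCost, ← Finset.sum_add_distrib]
  refine Finset.sum_le_sum fun p _ => ?_
  rw [Finset.sum_ite_eq]
  have hpo := hn.distTo_eq p
  split_ifs with h
  · have hA := (hnear (n p)).1
    have hne : (psi near OPT (near (n p))).Nonempty := ⟨n p, mem_psi.2 ⟨(hn p).1, rfl⟩⟩
    obtain ⟨h1, h2⟩ := hf _ hA hne
    have h3 := distTo_le_dist (mem_removeCenters.2 ⟨(mem_psi.1 h1).1, hH _ hA hne⟩) p
    have h4 := h2 (n p) (mem_psi.2 ⟨(hn p).1, rfl⟩)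
    have h5 := (hnear (n p)).2 _ (hnear p).1
    have h6 := hnear.distTo_eq p
    linarith [dist_triangle p (n p) (f (near (n p))),
      dist_triangle (n p) (near (n p)) (f (near (n p))), dist_triangle (n p) p (near p),
      dist_comm (n p) p, dist_comm (n p) (near (n p))]
  · linarith [distTo_le_dist (mem_removeCenters.2 ⟨(hn p).1, h⟩) p]

open Classical in
theorem exists_removedCenters {d : ℕ} {A : Finset (Pt d)} {near : Pt d → Pt d}
    {P OPT : Finset (Pt d)} {f : Pt d → Pt d} (hnear : IsNearestMap A near)
    (hf : IsClosestChoice near A OPT f) (hne : OPT.Nonempty) (hcard : A.card = OPT.card)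
    {δ : ℝ} (hδ : 0 ≤ δ) :
    ∃ H ⊆ optMulti near OPT,
      (H.card : ℝ) ≤ δ * (optMulti near OPT).card ∧
      (∀ l ∈ A, (psi near OPT l).Nonempty → f l ∉ H) ∧
      kmCost P (removeCenters OPT H) ≤ kmCost P OPT + δ * (2 * (kmCost P OPT + kmCost P A)) ∧
      ∀ c : ℕ, c ≤ (idleCenters near A OPT).card →
        (c : ℝ) ≤ δ * (idleCenters near A OPT).card → c ≤ H.card := by
  obtain ⟨n, hn⟩ := exists_isNearestMap hne
  set I := (A.filter fun l => (psi near OPT l).Nonempty).image f with hI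
  set F := OPT \ I with hF
  have hIsub : I ⊆ OPT := by
    intro g hg
    obtain ⟨l, hl, rfl⟩ := Finset.mem_image.1 hg
    obtain ⟨hlA, hl⟩ := Finset.mem_filter.1 hl
    exact (mem_psi.1 (hf l hlA hl).1).1
  -- The non-idle centers of `A` correspond to the values of `f`; equal sizes of `A` and `OPT` match
  -- the complements.
  have hFcard : F.card = (idleCenters near A OPT).card := by
    have h1 : F.card + I.card = OPT.card := Finset.card_sdiff_add_card_eq_card hIsub
    have h2 : I.card = (A.filter fun l => (psi near OPT l).Nonempty).card :=
      hf.card_image (Finset.Subset.refl A)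
    have h3 := Finset.card_filter_add_card_filter_not (s := A)
      (fun l => (psi near OPT l).Nonempty)
    rw [idleCenters]
    omega
  have hFm : F ⊆ optMulti near OPT := by
    intro g hg
    obtain ⟨hgO, hgI⟩ := Finset.mem_sdiff.1 hg
    have hgp : g ∈ psi near OPT (near g) := mem_psi.2 ⟨hgO, rfl⟩
    have hfp := (hf (near g) (hnear g).1 ⟨g, hgp⟩).1
    refine Finset.mem_filter.2 ⟨hgO, Finset.one_lt_card.2 ⟨g, hgp, _, hfp, fun h => hgI ?_⟩⟩
    rw [h]
    exact Finset.mem_image_of_mem f (Finset.mem_filter.2 ⟨(hnear g).1, ⟨g, hgp⟩⟩)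
  set w : Pt d → ℝ := fun g => ∑ p ∈ P, if n p = g then 2 * (distTo OPT p + distTo A p) else 0
    with hw
  have hw0 : ∀ g, 0 ≤ w g := fun g => Finset.sum_nonneg fun p _ => by
    have := distTo_nonneg OPT p
    have := distTo_nonneg A p
    split_ifs <;> positivity
  have hwF : ∑ g ∈ F, w g ≤ 2 * (kmCost P OPT + kmCost P A) := by
    rw [hw, Finset.sum_comm, kmCost, kmCost, ← Finset.sum_add_distrib, Finset.mul_sum]
    refine Finset.sum_le_sum fun p _ => ?_
    have := distTo_nonneg OPT p
    have := distTo_nonneg A p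
    rw [Finset.sum_ite_eq]
    split_ifs <;> linarith
  have hfl := Nat.floor_le (mul_nonneg hδ (Nat.cast_nonneg (α := ℝ) F.card))
  -- The cap matters because `δ` may exceed one.
  set m := min ⌊δ * F.card⌋₊ F.card with hm
  have hmδ : (m : ℝ) ≤ δ * F.card :=
    le_trans (Nat.cast_le.2 (min_le_left _ _)) hfl
  obtain ⟨H, hHF, hHm, hle⟩ := exists_subset_card_eq_mul_sum_le w F m (min_le_right _ _)
  have hHf : ∀ l ∈ A, (psi near OPT l).Nonempty → f l ∉ H := fun l hl hlne hlH =>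
    (Finset.mem_sdiff.1 (hHF hlH)).2
      (Finset.mem_image_of_mem f (Finset.mem_filter.2 ⟨hl, hlne⟩))
  refine ⟨H, hHF.trans hFm, ?_, hHf, ?_, ?_⟩
  · rw [hHm]
    refine hmδ.trans (mul_le_mul_of_nonneg_left ?_ hδ)
    exact_mod_cast Finset.card_le_card hFm
  · refine (kmCost_removeCenters_le hnear hn hf hHf).trans (add_le_add le_rfl ?_)
    change ∑ g ∈ H, w g ≤ _
    have hF0 : 0 ≤ ∑ g ∈ F, w g := Finset.sum_nonneg fun g _ => hw0 g
    refine le_trans ?_ (mul_le_mul_of_nonneg_left hwF hδ)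
    rcases Nat.eq_zero_or_pos F.card with h0 | h0
    · have : H = ∅ := by
        rw [Finset.card_eq_zero] at h0
        exact Finset.subset_empty.1 (h0 ▸ hHF)
      rw [this, Finset.sum_empty]
      positivity
    · have h0' : (0 : ℝ) < F.card := by exact_mod_cast h0
      refine le_of_mul_le_mul_left (hle.trans ?_) h0'
      calc (m : ℝ) * ∑ g ∈ F, w g ≤ δ * F.card * ∑ g ∈ F, w g :=
            mul_le_mul_of_nonneg_right hmδ hF0
        _ = _ := by ring
  · intro c hc hcδ
    rw [hHm, hm, hFcard]
    exact le_min (Nat.le_floor hcδ) hc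

/-! ### Upper bounds on means -/

/-- `f` is dominated by an integrable function of mean at most `c`. -/
def MeanLE {Ω : Type*} [MeasurableSpace Ω] (μ : Measure Ω) (f : Ω → ℝ) (c : ℝ) : Prop :=
  ∃ g : Ω → ℝ, Integrable g μ ∧ (∀ a, f a ≤ g a) ∧ ∫ a, g a ∂μ ≤ c

namespace MeanLE

variable {Ω : Type*} [MeasurableSpace Ω] {μ : Measure Ω} {f f₁ f₂ : Ω → ℝ} {c c₁ c₂ : ℝ}

theorem mono (h : MeanLE μ f₂ c₁) (hf : ∀ a, f₁ a ≤ f₂ a) (hc : c₁ ≤ c₂) : MeanLE μ f₁ c₂ := by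
  obtain ⟨g, hg, hfg, hgc⟩ := h
  exact ⟨g, hg, fun a => (hf a).trans (hfg a), hgc.trans hc⟩

theorem add (h₁ : MeanLE μ f₁ c₁) (h₂ : MeanLE μ f₂ c₂) :
    MeanLE μ (fun a => f₁ a + f₂ a) (c₁ + c₂) := by
  obtain ⟨g₁, hg₁, hf₁, hc₁⟩ := h₁
  obtain ⟨g₂, hg₂, hf₂, hc₂⟩ := h₂
  refine ⟨fun a => g₁ a + g₂ a, hg₁.add hg₂, fun a => add_le_add (hf₁ a) (hf₂ a), ?_⟩
  rw [integral_add hg₁ hg₂]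
  exact add_le_add hc₁ hc₂

theorem const_mul (h : MeanLE μ f c) {b : ℝ} (hb : 0 ≤ b) :
    MeanLE μ (fun a => b * f a) (b * c) := by
  obtain ⟨g, hg, hf, hc⟩ := h
  refine ⟨fun a => b * g a, hg.const_mul b, fun a => mul_le_mul_of_nonneg_left (hf a) hb, ?_⟩
  rw [integral_const_mul]
  exact mul_le_mul_of_nonneg_left hc hb

theorem const [IsProbabilityMeasure μ] (c : ℝ) : MeanLE μ (fun _ => c) c :=
  ⟨fun _ => c, integrable_const c, fun _ => le_rfl, by simp⟩

theorem sum {ι : Type*} (s : Finset ι) {f : ι → Ω → ℝ} {c : ι → ℝ}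
    (h : ∀ i ∈ s, MeanLE μ (f i) (c i)) : MeanLE μ (fun a => ∑ i ∈ s, f i a) (∑ i ∈ s, c i) := by
  classical
  induction s using Finset.induction_on with
  | empty => exact ⟨fun _ => 0, integrable_zero _ _ _, fun a => by simp, by simp⟩
  | insert i s hi ih =>
    simp only [Finset.sum_insert hi]
    exact (h i (Finset.mem_insert_self i s)).add
      (ih fun j hj => h j (Finset.mem_insert_of_mem hj))

open Classical in
-- Passing to a measurable hull gives an integrable majorant, so events of the shift need not be
-- shown measurable.
theorem ite [IsFiniteMeasure μ] {E : Ω → Prop} {q : ℝ} (h : μ.real {a | E a} ≤ q) :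
    MeanLE μ (fun a => if E a then 1 else 0) q := by
  set T := toMeasurable μ {a | E a} with hT
  have hTm : MeasurableSet T := measurableSet_toMeasurable _ _
  refine ⟨T.indicator 1, (integrable_const (1 : ℝ)).indicator hTm, fun a => ?_, ?_⟩
  · dsimp only
    split_ifs with ha
    · have haT : a ∈ T := subset_toMeasurable μ {a | E a} ha
      rw [Set.indicator_of_mem haT]
      exact le_rfl
    · exact Set.indicator_nonneg (fun _ _ => zero_le_one) a
  · rw [integral_indicator_one hTm, measureReal_def, hT, measure_toMeasurable]
    exact h

/-- Markov's inequality. -/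
theorem measureReal_lt_le [IsFiniteMeasure μ] (h : MeanLE μ f c) (hf : ∀ a, 0 ≤ f a)
    {t : ℝ} (ht : 0 < t) : μ.real {a | t * c < f a} ≤ 1 / t := by
  obtain ⟨g, hg, hfg, hgc⟩ := h
  have hg0 : ∀ a, 0 ≤ g a := fun a => (hf a).trans (hfg a)
  have hI : 0 ≤ ∫ a, g a ∂μ := integral_nonneg hg0
  -- For `c = 0` the majorant vanishes almost everywhere, and the strict inequality makes the event
  -- null.
  rcases (hI.trans hgc).eq_or_lt with hc | hc
  · have hz : g =ᵐ[μ] 0 := (integral_eq_zero_iff_of_nonneg hg0 hg).1 (by linarith)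
    have h0 : μ {a | t * c < f a} = 0 := by
      refine measure_mono_null (fun a ha => ?_) (ae_iff.1 hz)
      have ha' : t * c < f a := ha
      rw [← hc, mul_zero] at ha'
      exact (ha'.trans_le (hfg a)).ne'
    rw [measureReal_def, h0, ENNReal.toReal_zero]
    positivity
  · have h1 := mul_meas_ge_le_integral_of_nonneg (Filter.Eventually.of_forall hg0) hg (t * c)
    have h2 : μ.real {a | t * c < f a} ≤ μ.real {a | t * c ≤ g a} :=
      measureReal_mono fun a ha => (le_of_lt ha).trans (hfg a)
    rw [le_div_iff₀ ht]
    have h3 : μ.real {a | t * c ≤ g a} * t ≤ 1 := by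
      refine le_of_mul_le_mul_left ?_ hc
      linarith
    exact (mul_le_mul_of_nonneg_right h2 ht.le).trans h3

end MeanLE

theorem one_sub_le_measureReal {Ω : Type*} [MeasurableSpace Ω] {μ : Measure Ω}
    [IsProbabilityMeasure μ] {s b : Set Ω} (h : ∀ a, a ∉ b → a ∈ s) :
    1 - μ.real b ≤ μ.real s := by
  have h1 : μ.real (s ∪ b) = 1 := by
    rw [Set.eq_univ_of_forall (s := s ∪ b) fun a => by
      by_cases ha : a ∈ b
      exacts [Or.inr ha, Or.inl (h a ha)]]
    exact probReal_univ
  linarith [measureReal_union_le (μ := μ) s b]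

/-! ### Probability that a ball is cut -/

theorem isProbabilityMeasure_shift {M : ℤ} : IsProbabilityMeasure
    (ProbabilityTheory.cond (volume : Measure ℝ) (Set.Ico 0 ((2 : ℝ) ^ M))) := by
  have h : (0 : ℝ) < 2 ^ M := by positivity
  refine ProbabilityTheory.cond_isProbabilityMeasure_of_finite ?_ ?_
  · rw [Real.volume_Ico, sub_zero]
    exact (ENNReal.ofReal_pos.2 h).ne'
  · rw [Real.volume_Ico]
    exact ENNReal.ofReal_ne_top

instance isProbabilityMeasure_shiftLaw (d : ℕ) (M : ℤ) : IsProbabilityMeasure (shiftLaw d M) := by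
  have := @isProbabilityMeasure_shift M
  unfold shiftLaw
  infer_instance

/-- A cut needs a grid point between `c - r + t` and `c + r + t`. If `2r < s`, only `N + 1` grid
points can get there, each for shifts in an interval of length `2r`; otherwise the bound exceeds the
whole length `N s`. -/
theorem volume_shift_cut_le (c r s : ℝ) (N : ℕ) (hN : 1 ≤ N) (hs : 0 < s) (hr : 0 ≤ r) :
    (volume : Measure ℝ).real
        (Set.Ico 0 (N * s) ∩ {t | ⌊(c - r + t) / s⌋ ≠ ⌊(c + r + t) / s⌋}) ≤ 4 * r * N := by
  have hN' : (1 : ℝ) ≤ N := by exact_mod_cast hN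
  rcases le_or_gt s (2 * r) with hrs | hrs
  · calc _ ≤ (volume : Measure ℝ).real (Set.Ico 0 (N * s)) :=
          measureReal_mono Set.inter_subset_left (by rw [Real.volume_Ico]; exact ENNReal.ofReal_ne_top)
      _ = N * s := by rw [Real.volume_real_Ico_of_le (by positivity), sub_zero]
      _ ≤ 4 * r * N := by nlinarith
  set n₀ := ⌊(c - r) / s⌋ with hn₀
  have hn₀' : c - r < (n₀ + 1) * s := by
    have := Int.lt_floor_add_one ((c - r) / s)
    rwa [← hn₀, div_lt_iff₀ hs] at this
  have hn₀'' : (n₀ : ℝ) * s ≤ c - r := by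
    have := Int.floor_le ((c - r) / s)
    rwa [← hn₀, le_div_iff₀ hs] at this
  have hsub : Set.Ico 0 (N * s) ∩ {t | ⌊(c - r + t) / s⌋ ≠ ⌊(c + r + t) / s⌋} ⊆
      ⋃ m ∈ Finset.range (N + 1),
        Set.Ico ((n₀ + 1 + m) * s - c - r) ((n₀ + 1 + m) * s - c + r) := by
    rintro t ⟨⟨ht0, htN⟩, ht⟩
    set n := ⌊(c + r + t) / s⌋ with hn
    have hle : ⌊(c - r + t) / s⌋ ≤ n := Int.floor_le_floor (by gcongr; linarith)
    have hlt : (c - r + t) / s < n := Int.floor_lt.1 (lt_of_le_of_ne hle ht)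
    rw [div_lt_iff₀ hs] at hlt
    have hge : (n : ℝ) * s ≤ c + r + t := by
      have := Int.floor_le ((c + r + t) / s)
      rwa [← hn, le_div_iff₀ hs] at this
    -- The grid point that is crossed has index from `n₀ + 1` to `n₀ + N + 1`; the upper end uses
    -- `2r < s`.
    have h1 : n₀ < n := by
      have : (n₀ : ℝ) * s < n * s := by linarith
      exact_mod_cast lt_of_mul_lt_mul_right this hs.le
    have h2 : n < n₀ + N + 2 := by
      have : (n : ℝ) * s < (n₀ + N + 2) * s := by linarith
      exact_mod_cast lt_of_mul_lt_mul_right this hs.le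
    have h3 : (n₀ : ℝ) + 1 + ((n - n₀ - 1).toNat : ℕ) = n := by
      have : (((n - n₀ - 1).toNat : ℤ)) = n - n₀ - 1 := Int.toNat_of_nonneg (by omega)
      have h4 : (((n - n₀ - 1).toNat : ℕ) : ℝ) = n - n₀ - 1 := by exact_mod_cast this
      rw [h4]
      ring
    refine Set.mem_biUnion (x := (n - n₀ - 1).toNat) ?_ ?_
    · simp only [Finset.coe_range, Set.mem_Iio]
      omega
    · rw [h3]
      constructor <;> linarith
  have hfin : (volume : Measure ℝ) (⋃ m ∈ Finset.range (N + 1),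
      Set.Ico ((n₀ + 1 + m) * s - c - r) ((n₀ + 1 + m) * s - c + r)) ≠ ⊤ := by
    refine ((measure_biUnion_finset_le _ _).trans_lt (ENNReal.sum_lt_top.2 fun m _ => ?_)).ne
    rw [Real.volume_Ico]
    exact ENNReal.ofReal_lt_top
  calc _ ≤ _ := measureReal_mono hsub hfin
    _ ≤ _ := measureReal_biUnion_finset_le _ _
    _ = ∑ m ∈ Finset.range (N + 1), 2 * r := by
      refine Finset.sum_congr rfl fun m _ => ?_
      rw [Real.volume_real_Ico_of_le (by linarith)]
      ring
    _ = (N + 1) * (2 * r) := by simp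
    _ ≤ 4 * r * N := by nlinarith

theorem shift_cut_le (M i : ℤ) (hi : i < M) (c r : ℝ) (hr : 0 ≤ r) :
    (ProbabilityTheory.cond (volume : Measure ℝ) (Set.Ico 0 ((2 : ℝ) ^ M))).real
        {t | ⌊(c - r + t) / (2 : ℝ) ^ (i + 1)⌋ ≠ ⌊(c + r + t) / (2 : ℝ) ^ (i + 1)⌋} ≤
      2 * r / 2 ^ i := by
  obtain ⟨m, hm⟩ := Int.le.dest (show i + 1 ≤ M by omega)
  have hM : (2 : ℝ) ^ M = ((2 ^ m : ℕ) : ℝ) * 2 ^ (i + 1) := by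
    rw [← hm, zpow_add₀ two_ne_zero, zpow_natCast]
    push_cast
    ring
  have hs : (0 : ℝ) < 2 ^ (i + 1) := by positivity
  have hM0 : (0 : ℝ) < 2 ^ M := by positivity
  have h := volume_shift_cut_le c r (2 ^ (i + 1)) (2 ^ m) Nat.one_le_two_pow hs hr
  rw [← hM] at h
  rw [measureReal_def, ProbabilityTheory.cond_apply measurableSet_Ico, ENNReal.toReal_mul,
    ENNReal.toReal_inv, ← measureReal_def, ← measureReal_def,
    Real.volume_real_Ico_of_le hM0.le, sub_zero, inv_mul_le_iff₀ hM0]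
  refine h.trans (le_of_eq ?_)
  rw [hM, zpow_add_one₀ two_ne_zero]
  field_simp
  ring

/-- The ball lies in the cube of half-side `r`, and the floor is monotone, so equal cells at both
ends of a coordinate interval leave no cut in that coordinate. -/
theorem quadtree_cutsAt_closedBall {d : ℕ} {M : ℤ} {o : Pt d} {a : Fin d → ℝ} {i : ℤ} {x : Pt d}
    {r : ℝ} (h : (quadtree M o a).CutsAt i (Metric.closedBall x r)) :
    i < M ∧ 0 ≤ r ∧ ∃ j, ⌊(x j - o j - r + a j) / (2 : ℝ) ^ (i + 1)⌋ ≠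
      ⌊(x j - o j + r + a j) / (2 : ℝ) ^ (i + 1)⌋ := by
  obtain ⟨u, hu, v, hv, huv⟩ := h
  change ¬ ((if i < M then gridIndex o a i u else 0) = (if i < M then gridIndex o a i v else 0))
    at huv
  have hi : i < M := by
    by_contra hi
    simp [hi] at huv
  rw [if_pos hi, if_pos hi] at huv
  refine ⟨hi, dist_nonneg.trans (Metric.mem_closedBall.1 hu), ?_⟩
  obtain ⟨j, hj⟩ := Function.ne_iff.1 huv
  refine ⟨j, fun heq => hj ?_⟩
  have key : ∀ w ∈ Metric.closedBall x r, gridIndex o a i w j =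
      ⌊(x j - o j - r + a j) / (2 : ℝ) ^ (i + 1)⌋ := by
    intro w hw
    have h1 : |w j - x j| ≤ r := by
      have h2 := PiLp.norm_apply_le (w - x) j
      rw [← dist_eq_norm] at h2
      exact h2.trans hw
    obtain ⟨h3, h4⟩ := abs_le.1 h1
    refine le_antisymm (heq ▸ Int.floor_le_floor ?_) (Int.floor_le_floor ?_) <;>
      exact div_le_div_of_nonneg_right (by linarith) (by positivity)
  rw [key u hu, key v hv]

theorem shiftLaw_cutsAt_le {d : ℕ} (M : ℤ) (o : Pt d) (i : ℤ) (x : Pt d) {r : ℝ} (hr : 0 ≤ r) :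
    (shiftLaw d M).real {a | (quadtree M o a).CutsAt i (Metric.closedBall x r)} ≤
      2 * d * r / 2 ^ i := by
  by_cases hi : i < M
  swap
  · have : {a | (quadtree M o a).CutsAt i (Metric.closedBall x r)} = ∅ :=
      Set.eq_empty_of_forall_notMem fun a ha => hi (quadtree_cutsAt_closedBall ha).1
    rw [this, measureReal_empty]
    positivity
  have := @isProbabilityMeasure_shift M
  set T : Fin d → Set ℝ := fun j => {t | ⌊(x j - o j - r + t) / (2 : ℝ) ^ (i + 1)⌋ ≠
      ⌊(x j - o j + r + t) / (2 : ℝ) ^ (i + 1)⌋} with hT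
  have hTm : ∀ j, MeasurableSet (T j) := fun j =>
    (measurableSet_eq_fun (Int.measurable_floor.comp (by fun_prop))
      (Int.measurable_floor.comp (by fun_prop))).compl
  calc _ ≤ (shiftLaw d M).real (⋃ j, (Function.eval j) ⁻¹' T j) :=
        measureReal_mono fun a ha => by
          obtain ⟨-, -, j, hj⟩ := quadtree_cutsAt_closedBall ha
          exact Set.mem_iUnion.2 ⟨j, hj⟩
    _ ≤ ∑ j, (shiftLaw d M).real ((Function.eval j) ⁻¹' T j) := measureReal_iUnion_fintype_le _
    _ ≤ ∑ _j : Fin d, 2 * r / 2 ^ i := by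
      refine Finset.sum_le_sum fun j _ => ?_
      rw [measureReal_def, shiftLaw, (measurePreserving_eval _ j).measure_preimage
        (hTm j).nullMeasurableSet, ← measureReal_def]
      exact shift_cut_le M i hi _ r hr
    _ = 2 * d * r / 2 ^ i := by
      rw [Finset.sum_const, Finset.card_univ, Fintype.card_fin, nsmul_eq_mul]
      ring

theorem shiftLaw_badlyCutBall_le {d : ℕ} (M : ℤ) (o : Pt d) (x : Pt d) {r ε : ℝ} (hr : 0 ≤ r)
    (hd : 1 ≤ d) (hε : 0 < ε) :
    (shiftLaw d M).real {a | BadlyCutBall (quadtree M o a) ε x r} ≤ 2 * ε := by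
  have hd' : (0 : ℝ) < d := by exact_mod_cast hd
  -- A ball of radius zero is a point and is never cut.
  rcases hr.eq_or_lt with rfl | hr0
  · have : {a | BadlyCutBall (quadtree M o a) ε x 0} = ∅ := by
      refine Set.eq_empty_of_forall_notMem fun a ha => ha.1 ?_
      rcases (quadtree M o a).cutLevel_cases (Metric.closedBall x 0) with h | ⟨i, -, h, -⟩
      · exact h.1
      · obtain ⟨-, -, j, hj⟩ := quadtree_cutsAt_closedBall h
        simp at hj
    rw [this, measureReal_empty]
    positivity
  set R := r * (d / ε) with hR
  have hR0 : 0 < R := by positivity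
  -- With `i` the least level at which `2^i` reaches the threshold, a bad cut at any level implies a
  -- cut at level `i`, since finer partitions cut too.
  obtain ⟨i, hi, hi'⟩ : ∃ i : ℤ, R ≤ 2 ^ i ∧ ∀ j : ℤ, R ≤ 2 ^ j → i ≤ j := by
    refine ⟨Int.clog 2 R, by exact_mod_cast Int.self_le_zpow_clog one_lt_two R, fun j hj => ?_⟩
    exact (Int.le_zpow_iff_clog_le one_lt_two hR0).1 (by exact_mod_cast hj)
  calc _ ≤ (shiftLaw d M).real {a | (quadtree M o a).CutsAt i (Metric.closedBall x r)} := by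
        refine measureReal_mono fun a ha => ?_
        obtain ⟨h1, h2⟩ := ha
        rw [rpow_tau hd hε, ← hR] at h2
        rcases (quadtree M o a).cutLevel_cases (Metric.closedBall x r) with h | ⟨l, h, hc, -⟩
        · exact absurd h.1 h1
        · rw [HierDecomp.level, h, twoPow_coe] at h2
          exact hc.anti (hi' l h2)
    _ ≤ 2 * d * r / 2 ^ i := shiftLaw_cutsAt_le M o i x hr
    _ ≤ 2 * d * r / R := by gcongr
    _ = 2 * ε := by rw [hR]; field_simp

theorem half_le_log_inv {ε : ℝ} (hε : 0 < ε) (hε2 : ε ≤ 1 / 2) : 1 / 2 ≤ Real.log (1 / ε) := by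
  have h2 : (2 : ℝ) ≤ 1 / ε := by
    rw [le_div_iff₀ hε]
    linarith
  linarith [Real.log_two_gt_d9, Real.log_le_log two_pos h2]

open Classical in
/-- The contribution of the levels that are not too high to the detour. -/
theorem meanLE_truncated_detour {d : ℕ} (M : ℤ) (o : Pt d) (x : Pt d) {r ε : ℝ} (hr : 0 ≤ r)
    (hd : 1 ≤ d) (hε : 0 < ε) (hε2 : ε ≤ 1 / 2) :
    MeanLE (shiftLaw d M) (fun a =>
        if twoPow ((quadtree M o a).level x r) ≤ r * (d / ε)
        then twoPow ((quadtree M o a).level x r) else 0)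
      (8 * d * r * Real.log (1 / ε)) := by
  have hd' : (0 : ℝ) < d := by exact_mod_cast hd
  have hlog := half_le_log_inv hε hε2
  rcases hr.eq_or_lt with rfl | hr0
  · refine (MeanLE.const 0).mono (fun a => ?_) (by simp)
    split_ifs with h <;> linarith
  have hrd : 0 < r * d := by positivity
  set L := Int.log 2 (r * d) with hL
  have hL1 : r * d < (2 : ℝ) ^ (L + 1) := by
    exact_mod_cast Int.lt_zpow_succ_log_self (b := 2) one_lt_two (r * d)
  -- Levels above `L` but below the threshold `r d / ε` are `L + 1 + m` with `2^m < 1/ε`, hence `m <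
  -- n`.
  set n := ⌈Real.logb 2 (1 / ε)⌉₊ with hn
  have hn' : (n : ℝ) ≤ 3 * Real.log (1 / ε) := by
    have h1 : 1 ≤ Real.logb 2 (1 / ε) := by
      rw [Real.le_logb_iff_rpow_le one_lt_two (by positivity), Real.rpow_one, le_div_iff₀ hε]
      linarith
    have h2 := Nat.ceil_lt_add_one (zero_le_one.trans h1)
    have h3 : Real.logb 2 (1 / ε) ≤ 3 / 2 * Real.log (1 / ε) := by
      rw [Real.logb, div_le_iff₀ (Real.log_pos one_lt_two)]
      have := Real.log_two_gt_d9
      nlinarith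
    linarith
  have hsum := (MeanLE.const (μ := shiftLaw d M) (r * d)).add
    (MeanLE.sum (Finset.range n) fun m _ =>
      (MeanLE.ite (shiftLaw_cutsAt_le M o (L + 1 + m) x hr)).const_mul
        (b := (2 : ℝ) ^ (L + 1 + m)) (by positivity))
  refine hsum.mono (fun a => ?_) ?_
  · have hnn : ∀ m ∈ Finset.range n, 0 ≤ (2 : ℝ) ^ (L + 1 + m) *
        (if (quadtree M o a).CutsAt (L + 1 + m) (Metric.closedBall x r) then 1 else 0) := by
      intro m _
      split_ifs <;> positivity
    have h0 := Finset.sum_nonneg hnn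
    split_ifs with h
    · rcases (quadtree M o a).cutLevel_cases (Metric.closedBall x r) with h' | ⟨l, h', hc, -⟩
      · rw [HierDecomp.level, h'.1, twoPow_bot]
        linarith
      · rw [HierDecomp.level, h', twoPow_coe] at h ⊢
        rcases le_or_gt l L with hl | hl
        · have h1 : (2 : ℝ) ^ L ≤ r * d := by
            exact_mod_cast Int.zpow_log_le_self (b := 2) one_lt_two hrd
          have h2 : (2 : ℝ) ^ l ≤ 2 ^ L := zpow_le_zpow_right₀ one_le_two hl
          linarith
        · obtain ⟨m, rfl⟩ := Int.le.dest (show L + 1 ≤ l by omega)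
          have hm : m ∈ Finset.range n := by
            rw [Finset.mem_range, ← Nat.cast_lt (α := ℝ)]
            refine lt_of_lt_of_le ?_ (Nat.le_ceil _)
            rw [Real.lt_logb_iff_rpow_lt one_lt_two (by positivity), Real.rpow_natCast,
              lt_div_iff₀ hε]
            rw [zpow_add₀ two_ne_zero, zpow_natCast] at h
            have h3 : (2 : ℝ) ^ (L + 1) * (2 ^ m * ε) ≤ r * d := by
              calc _ = (2 : ℝ) ^ (L + 1) * 2 ^ m * ε := by ring
                _ ≤ r * (d / ε) * ε := by gcongr
                _ = r * d := by field_simp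
            by_contra hge
            have h4 : (2 : ℝ) ^ (L + 1) * 1 ≤ 2 ^ (L + 1) * (2 ^ m * ε) := by
              gcongr
              exact not_lt.1 hge
            linarith
          have h5 := Finset.single_le_sum hnn hm
          rw [if_pos hc, mul_one] at h5
          linarith
    · linarith
  · have h1 : ∀ m ∈ Finset.range n,
        (2 : ℝ) ^ (L + 1 + m) * (2 * d * r / 2 ^ (L + 1 + m)) = 2 * d * r := by
      intro m _
      field_simp
    rw [Finset.sum_congr rfl h1, Finset.sum_const, Finset.card_range, nsmul_eq_mul]
    nlinarith

theorem meanLE_detourOr {d : ℕ} (M : ℤ) (o : Pt d) (x : Pt d) {r ε v : ℝ} (hr : 0 ≤ r)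
    (hd : 1 ≤ d) (hε : 0 < ε) (hε2 : ε ≤ 1 / 2) (hv : 0 ≤ v) :
    MeanLE (shiftLaw d M) (fun a => detourOr (quadtree M o a) ε x r v)
      (ε * (d * Real.log (1 / ε) * (8 * r + 4 * v))) := by
  classical
  have hd' : (1 : ℝ) ≤ d := by exact_mod_cast hd
  have hlog := half_le_log_inv hε hε2
  refine (((meanLE_truncated_detour M o x hr hd hε hε2).const_mul hε.le).add
    ((MeanLE.ite (shiftLaw_badlyCutBall_le M o x hr hd hε)).const_mul hv)).mono (fun a => ?_) ?_
  · rw [detourOr, rpow_tau hd hε]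
    split_ifs with h1 h2 h2
    · simpa [detour] using hv
    · simp [detour]
    · simp
    · exfalso
      have h3 : 0 ≤ r * (d / ε) := by positivity
      refine h2 ⟨fun hb => h1 (by simpa [hb] using h3), ?_⟩
      rw [rpow_tau hd hε]
      exact (not_le.1 h1).le
  -- This factor absorbs the term `2εv` of the badly cut case into `4v`.
  · have h4 : 1 ≤ 2 * (d * Real.log (1 / ε)) := by nlinarith
    have h5 : 0 ≤ v * ε := by positivity
    nlinarith

/-- All radii and default values are `O(A_p + S_p)`, because `S_{A(p)} ≤ A_p + S_p`. -/
theorem meanLE_budget {d : ℕ} (M : ℤ) (o : Pt d) {A : Finset (Pt d)} {near : Pt d → Pt d}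
    (hnear : IsNearestMap A near) (S : Finset (Pt d)) (p : Pt d) {ε : ℝ}
    (hd : 1 ≤ d) (hε : 0 < ε) (hε2 : ε ≤ 1 / 2) :
    MeanLE (shiftLaw d M) (fun a => budget (quadtree M o a) ε A near S p)
      (84 * d * Real.log (1 / ε) * ε * (distTo A p + distTo S p)) := by
  have hlog := half_le_log_inv hε hε2
  have hA := distTo_nonneg A p
  have hS := distTo_nonneg S p
  have hl := distTo_nonneg S (near p)
  have h1 := distTo_le_add S (near p) p
  rw [dist_comm, ← hnear.distTo_eq] at h1
  refine (((meanLE_detourOr M o p (r := 3 * distTo A p) (v := 0) (by linarith) hd hε hε2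
    le_rfl).add (meanLE_detourOr M o p (r := 3 * (distTo A p + distTo S p))
      (v := 3 * distTo A p + 2 * distTo S p) (by linarith) hd hε hε2 (by linarith))).add
    (meanLE_detourOr M o (near p) (r := 3 * distTo S (near p)) (v := 0) (by linarith) hd hε hε2
      le_rfl)).mono (fun a => le_rfl) ?_
  have h2 : 0 ≤ ε * (d * Real.log (1 / ε)) := by positivity
  calc _ = ε * (d * Real.log (1 / ε)) *
        (60 * distTo A p + 32 * distTo S p + 24 * distTo S (near p)) := by ring
    _ ≤ ε * (d * Real.log (1 / ε)) * (84 * (distTo A p + distTo S p)) := by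
        gcongr
        linarith
    _ = _ := by ring

theorem meanLE_sum_budget {d : ℕ} (M : ℤ) (o : Pt d) {A : Finset (Pt d)} {near : Pt d → Pt d}
    (hnear : IsNearestMap A near) (P S : Finset (Pt d)) {ε : ℝ}
    (hd : 1 ≤ d) (hε : 0 < ε) (hε2 : ε ≤ 1 / 2) :
    MeanLE (shiftLaw d M) (fun a => ∑ p ∈ P, budget (quadtree M o a) ε A near S p)
      (84 * d * Real.log (1 / ε) * ε * (kmCost P A + kmCost P S)) := by
  rw [kmCost, kmCost, ← Finset.sum_add_distrib, Finset.mul_sum]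
  exact MeanLE.sum P fun p _ => meanLE_budget M o hnear S p hd hε hε2

/-! ### Cost of the structured solution -/

open Classical in
/-- A bound for the cost of `S*` at `p` beyond `dist(p, OPT')`, where `n` is a nearest map of
`OPT'`. -/
noncomputable def excess {d : ℕ} (D : HierDecomp (Pt d)) (ε : ℝ) (A : Finset (Pt d))
    (near : Pt d → Pt d) (O : Finset (Pt d)) (n : Pt d → Pt d) (p : Pt d) : ℝ :=
  2 * distTo A p * (if BadlyCut D ε A p then 1 else 0) +
    (distTo O p + distTo A p) * (if BadlyCut D ε O (near (n p)) then 1 else 0)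

theorem excess_nonneg {d : ℕ} (D : HierDecomp (Pt d)) (ε : ℝ) (A : Finset (Pt d))
    (near : Pt d → Pt d) (O : Finset (Pt d)) (n : Pt d → Pt d) (p : Pt d) :
    0 ≤ excess D ε A near O n p := by
  have hA := distTo_nonneg A p
  have hO := distTo_nonneg O p
  unfold excess
  split_ifs <;> positivity

section

variable {d : ℕ} (D : HierDecomp (Pt d)) (ε : ℝ) {A : Finset (Pt d)}
  {near n : Pt d → Pt d} {OPT H : Finset (Pt d)} {f : Pt d → Pt d}

open Classical in
-- If the nearest `g` of `OPT'` was exchanged, `near g` replaces it, at extra distance at most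
-- `dist(g, A) ≤ O_p + A_p`.
theorem distTo_sStar_le (hnear : IsNearestMap A near) (hf : IsClosestChoice near A OPT f)
    (hn : IsNearestMap (removeCenters OPT H) n) (p : Pt d) :
    distTo (sStar D ε A near OPT H f) p ≤ distTo (removeCenters OPT H) p +
      (distTo (removeCenters OPT H) p + distTo A p) *
        (if BadlyCut D ε (removeCenters OPT H) (near (n p)) then 1 else 0) := by
  have hA := distTo_nonneg A p
  have hO := distTo_nonneg (removeCenters OPT H) p
  have hpo := hn.distTo_eq p
  rcases mem_sStar_or D ε hf (hn p).1 with h | ⟨h, hb⟩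
  · have h1 := distTo_le_dist h p
    split_ifs <;> linarith
  · rw [if_pos hb]
    have h1 := distTo_le_dist h p
    have h2 := (hnear (n p)).2 _ (hnear p).1
    have h3 := hnear.distTo_eq p
    linarith [dist_triangle p (n p) (near (n p)), dist_triangle (n p) p (near p),
      dist_comm (n p) p]

theorem kmCost_sStar_le (hnear : IsNearestMap A near) (hf : IsClosestChoice near A OPT f)
    (hn : IsNearestMap (removeCenters OPT H) n) (P : Finset (Pt d)) :
    kmCost P (sStar D ε A near OPT H f) ≤ kmCost P (removeCenters OPT H) +
      ∑ p ∈ P, excess D ε A near (removeCenters OPT H) n p := by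
  rw [kmCost, kmCost, ← Finset.sum_add_distrib]
  refine Finset.sum_le_sum fun p _ => (distTo_sStar_le D ε hnear hf hn p).trans ?_
  have hA := distTo_nonneg A p
  unfold excess
  split_ifs <;> linarith

theorem movedCost_sStar_le (hnear : IsNearestMap A near) (hf : IsClosestChoice near A OPT f)
    (hn : IsNearestMap (removeCenters OPT H) n) (P : Finset (Pt d)) :
    movedCost D ε A near P (sStar D ε A near OPT H f) ≤ kmCost P (removeCenters OPT H) +
      ∑ p ∈ P, excess D ε A near (removeCenters OPT H) n p := by
  rw [movedCost, kmCost, ← Finset.sum_add_distrib]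
  refine Finset.sum_le_sum fun p _ => ?_
  have h1 := distTo_sStar_le D ε hnear hf hn p
  have h2 := hnear.distTo_eq p
  unfold moved excess
  -- Moving `p` to `near p` costs `A_p` for the move and at most `A_p` more for the distance to
  -- `S*`.
  by_cases hp : BadlyCut D ε A p
  · rw [if_pos hp, if_pos hp]
    have h3 := distTo_le_add (sStar D ε A near OPT H f) (near p) p
    rw [dist_comm] at h3
    linarith
  · rw [if_neg hp, if_neg hp, dist_self]
    linarith

end

theorem meanLE_sum_excess {d : ℕ} (M : ℤ) (o : Pt d) {ε : ℝ} (hd : 1 ≤ d) (hε : 0 < ε)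
    (A : Finset (Pt d)) (near : Pt d → Pt d) (O : Finset (Pt d)) (n : Pt d → Pt d)
    (P : Finset (Pt d)) :
    MeanLE (shiftLaw d M) (fun a => ∑ p ∈ P, excess (quadtree M o a) ε A near O n p)
      (6 * ε * (kmCost P A + kmCost P O)) := by
  rw [kmCost, kmCost, ← Finset.sum_add_distrib, Finset.mul_sum]
  refine MeanLE.sum P fun p _ => ?_
  have hA := distTo_nonneg A p
  have hO := distTo_nonneg O p
  have hbad : ∀ (S : Finset (Pt d)) (x : Pt d),
      (shiftLaw d M).real {a | BadlyCut (quadtree M o a) ε S x} ≤ 2 * ε := fun S x =>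
    shiftLaw_badlyCutBall_le M o x (mul_nonneg (by norm_num) (distTo_nonneg S x)) hd hε
  refine (((MeanLE.ite (hbad A p)).const_mul (b := 2 * distTo A p) (by positivity)).add
    ((MeanLE.ite (hbad O (near (n p)))).const_mul (b := distTo O p + distTo A p)
      (by positivity))).mono (fun a => le_rfl) ?_
  nlinarith

open Classical in
theorem meanLE_card_badlyCut {d : ℕ} (M : ℤ) (o : Pt d) {ε : ℝ} (hd : 1 ≤ d) (hε : 0 < ε)
    (I O : Finset (Pt d)) :
    MeanLE (shiftLaw d M)
      (fun a => ((I.filter fun l => BadlyCut (quadtree M o a) ε O l).card : ℝ))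
      (2 * ε * I.card) := by
  refine (MeanLE.sum I fun l _ => MeanLE.ite (shiftLaw_badlyCutBall_le M o l
    (mul_nonneg zero_le_three (distTo_nonneg O l)) hd hε)).mono (fun a => ?_) ?_
  · rw [Finset.natCast_card_filter]
    exact le_rfl
  · rw [Finset.sum_const, nsmul_eq_mul, mul_comm]

theorem mainTheorem6 :
    ∃ K : ℝ, 0 < K ∧
      ∀ (d k : ℕ) (M : ℤ) (o : Pt d) (P Cand A : Finset (Pt d)) (near : Pt d → Pt d) (ε : ℝ),
        1 ≤ d → 1 ≤ k → 0 < ε → ε ≤ 1 / 2 →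
        (∀ x, x ∈ P ∨ x ∈ Cand → ∀ j, o j ≤ x j ∧ x j < o j + (2 : ℝ) ^ M) →
        IsSolution k Cand A → IsNearestMap A near →
        -- the total budget w.r.t. `A` and any fixed set `S` of at most `k` centers
        (∀ S : Finset (Pt d), S ⊆ Cand → S.Nonempty → S.card ≤ k →
          2 / 3 ≤ (shiftLaw d M).real {a |
            ∑ p ∈ P, budget (quadtree M o a) ε A near S p
              ≤ K * d * Real.log (1 / ε) * ε * (kmCost P A + kmCost P S)}) ∧
        (∀ (OPT : Finset (Pt d)) (f : Pt d → Pt d),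
          IsOptimalSolution k Cand P OPT → IsClosestChoice near A OPT f →
          ∃ H : Finset (Pt d),
            -- the removed centers, chosen independently of the decomposition
            H ⊆ optMulti near OPT ∧
            (H.card : ℝ) ≤ K * ε * (optMulti near OPT).card ∧
            (∀ l ∈ A, (psi near OPT l).Nonempty → f l ∉ H) ∧
            kmCost P (removeCenters OPT H) ≤ (1 + K * ε) * kmCost P OPT + K * ε * kmCost P A ∧
            -- for every hierarchical decomposition
            (∀ D : HierDecomp (Pt d),
              sStar D ε A near OPT H f ⊆ Cand ∧
              badCenters D ε A (removeCenters OPT H) ⊆ sStar D ε A near OPT H f ∧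
              ∀ p ∈ P, DetourWithin D ε A near (sStar D ε A near OPT H f) p
                (budget D ε A near (removeCenters OPT H) p)) ∧
            -- size and cost of `S*`
            4 / 5 ≤ (shiftLaw d M).real {a |
              (sStar (quadtree M o a) ε A near OPT H f).card ≤ k ∧
              kmCost P (sStar (quadtree M o a) ε A near OPT H f)
                ≤ (1 + K * ε) * kmCost P OPT + K * ε * kmCost P A ∧
              movedCost (quadtree M o a) ε A near P (sStar (quadtree M o a) ε A near OPT H f)
                ≤ (1 + K * ε) * kmCost P OPT + K * ε * kmCost P A} ∧
            -- small total budget, and size and cost of `S*`, simultaneously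
            2 / 3 ≤ (shiftLaw d M).real {a |
              ∑ p ∈ P, budget (quadtree M o a) ε A near (removeCenters OPT H) p
                ≤ K * d * Real.log (1 / ε) * ε * (kmCost P A + kmCost P OPT) ∧
              (sStar (quadtree M o a) ε A near OPT H f).card ≤ k ∧
              movedCost (quadtree M o a) ε A near P (sStar (quadtree M o a) ε A near OPT H f)
                ≤ (1 + K * ε) * kmCost P OPT + K * ε * kmCost P A}) := by
  classical
  -- The largest demand is `10 · 84 · 41 = 34440`, from the budget with respect to `OPT'`.
  refine ⟨40000, by norm_num, ?_⟩
  intro d k M o P Cand A near ε hd hk hε hε2 _ hA hnear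
  have hd' : (0 : ℝ) < d := by exact_mod_cast hd
  have hlog : 0 < Real.log (1 / ε) := by linarith [half_le_log_inv hε hε2]
  have hA0 := kmCost_nonneg P A
  set c := d * Real.log (1 / ε) * ε with hc
  have hc0 : 0 < c := by positivity
  constructor
  · intro S _ _ _
    have hS0 := kmCost_nonneg P S
    have h1 := (meanLE_sum_budget M o hnear P S hd hε hε2).measureReal_lt_le
      (fun a => Finset.sum_nonneg fun p _ => budget_nonneg _ hε.le A near S p)
      (t := 10) (by norm_num)
    refine le_trans ?_ (one_sub_le_measureReal
      (b := {a | 10 * (84 * d * Real.log (1 / ε) * ε * (kmCost P A + kmCost P S)) <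
        ∑ p ∈ P, budget (quadtree M o a) ε A near S p}) fun a ha => ?_)
    · exact le_trans (by norm_num) (sub_le_sub_left h1 1)
    · simp only [Set.mem_ofPred_eq, not_lt] at ha
      refine ha.trans ?_
      have : 0 ≤ c * (kmCost P A + kmCost P S) := by positivity
      rw [hc] at this
      linarith
  · intro OPT f hOPT hf
    have hne : OPT.Nonempty := Finset.card_pos.1 (by have := hOPT.1.2; omega)
    -- The fraction `40ε` is the mean fraction `2ε` of badly cut idle centers times the Markov
    -- factor 20.
    obtain ⟨H, hHm, hHc, hHf, hHcost, hHcard⟩ := exists_removedCenters (P := P) hnear hf hne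
      (hA.2.trans hOPT.1.2.symm) (δ := 40 * ε) (by positivity)
    have hHO : H ⊆ OPT := hHm.trans (Finset.filter_subset _ _)
    have hO := removeCenters_nonempty hnear hf hne hHf
    obtain ⟨n, hn⟩ := exists_isNearestMap hO
    set O := removeCenters OPT H with hOdef
    have h0 := kmCost_nonneg P OPT
    have hO0 := kmCost_nonneg P O
    have hε0 : 0 ≤ ε * (kmCost P OPT + kmCost P A) := by positivity
    have hsum : kmCost P A + kmCost P O ≤ 41 * (kmCost P A + kmCost P OPT) := by
      have : ε * (kmCost P OPT + kmCost P A) ≤ 1 / 2 * (kmCost P OPT + kmCost P A) := by gcongr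
      linarith
    -- The three failures are too many badly cut idle centers, too large an excess cost and too
    -- large a budget, of probabilities at most 1/20, 1/20 and 1/10.
    set bad₁ := {a | 20 * (2 * ε * (idleCenters near A OPT).card) <
      (((idleCenters near A OPT).filter fun l => BadlyCut (quadtree M o a) ε O l).card : ℝ)}
      with hbad₁
    set bad₂ := {a | 20 * (6 * ε * (kmCost P A + kmCost P O)) <
      ∑ p ∈ P, excess (quadtree M o a) ε A near O n p} with hbad₂
    set bad₃ := {a | 10 * (84 * d * Real.log (1 / ε) * ε * (kmCost P A + kmCost P O)) <
      ∑ p ∈ P, budget (quadtree M o a) ε A near O p} with hbad₃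
    have hp₁ : (shiftLaw d M).real bad₁ ≤ 1 / 20 :=
      (meanLE_card_badlyCut M o hd hε (idleCenters near A OPT) O).measureReal_lt_le
        (fun a => Nat.cast_nonneg _) (t := 20) (by norm_num)
    have hp₂ : (shiftLaw d M).real bad₂ ≤ 1 / 20 :=
      (meanLE_sum_excess M o hd hε A near O n P).measureReal_lt_le
        (fun a => Finset.sum_nonneg fun p _ => excess_nonneg _ ε A near O n p) (t := 20) (by norm_num)
    have hp₃ : (shiftLaw d M).real bad₃ ≤ 1 / 10 :=
      (meanLE_sum_budget M o hnear P O hd hε hε2).measureReal_lt_le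
        (fun a => Finset.sum_nonneg fun p _ => budget_nonneg _ hε.le A near O p) (t := 10) (by norm_num)
    have hsize : ∀ a, a ∉ bad₁ → (sStar (quadtree M o a) ε A near OPT H f).card ≤ k := by
      intro a ha
      rw [← hOPT.1.2]
      refine card_sStar_le _ ε hf hHO hHf (hHcard _ (Finset.card_filter_le _ _) ?_)
      simp only [hbad₁, Set.mem_ofPred_eq, not_lt] at ha
      linarith
    have hexc : ∀ a, a ∉ bad₂ →
        kmCost P O + ∑ p ∈ P, excess (quadtree M o a) ε A near O n p ≤
          (1 + 40000 * ε) * kmCost P OPT + 40000 * ε * kmCost P A := by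
      intro a ha
      simp only [hbad₂, Set.mem_ofPred_eq, not_lt] at ha
      have h2 := mul_le_mul_of_nonneg_left hsum hε.le
      linarith
    have hcost := fun a => kmCost_sStar_le (quadtree M o a) ε hnear hf hn P
    have hmoved := fun a => movedCost_sStar_le (quadtree M o a) ε hnear hf hn P
    refine ⟨H, hHm, ?_, hHf, ?_, fun D => ⟨sStar_subset D ε near H f hA.1 hOPT.1.1,
      badCenters_subset_sStar D ε A near OPT H f,
      fun p _ => detourWithin_sStar D hε.le hnear hf hO p⟩, ?_, ?_⟩
    · refine hHc.trans ?_
      gcongr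
      norm_num
    · linarith
    · refine le_trans ?_ (one_sub_le_measureReal (b := bad₁ ∪ bad₂) fun a ha => ?_)
      · linarith [measureReal_union_le (μ := shiftLaw d M) bad₁ bad₂]
      · obtain ⟨ha₁, ha₂⟩ := not_or.1 ha
        exact ⟨hsize a ha₁, (hcost a).trans (hexc a ha₂), (hmoved a).trans (hexc a ha₂)⟩
    · refine le_trans ?_ (one_sub_le_measureReal (b := bad₁ ∪ bad₂ ∪ bad₃) fun a ha => ?_)
      · linarith [measureReal_union_le (μ := shiftLaw d M) bad₁ bad₂,
          measureReal_union_le (μ := shiftLaw d M) (bad₁ ∪ bad₂) bad₃]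
      · obtain ⟨ha', ha₃⟩ := not_or.1 ha
        obtain ⟨ha₁, ha₂⟩ := not_or.1 ha'
        refine ⟨(not_lt.1 ha₃).trans ?_, hsize a ha₁, (hmoved a).trans (hexc a ha₂)⟩
        have h1 := mul_le_mul_of_nonneg_left hsum hc0.le
        have h2 : 0 ≤ c * (kmCost P A + kmCost P OPT) := by positivity
        rw [hc] at h1 h2
        linarith
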